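/- For integers $n,p\ge 1$ and $z\in\mathbb{C}\setminus(1,\infty)$ let \[ S_{n,p}(z)=\frac{(-1)^{n+p-1}}{(n-1)!\,p!}\int_0^1 \log^{n-1}(t)\,\log^{p}(1-zt)\,\frac{dt}{t} \] (principal branch of the logarithm) be the Nielsen polylogarithm, let $\mathrm{Li}_m(z)=\sum_{k\ge 1} z^k/k^m$ for $m\ge 2$, $|z|\le 1$ be the classical polylogarithm, and let $\zeta$ be the Riemann zeta function. Then: (1) \[ S_{3,3}(-1)=\frac32\,S_{4,2}(-1)+\frac{5}{16}\,\zeta(6)-\frac14\,\zeta(3)^2 . \] (2) With $\omega=e^{2\pi i/6}$, \[ S_{3,3}(\omega)=3\,\mathrm{Li}_6(\omega)-\frac12\,\zeta(3)^2-\frac{1829}{1944}\,\zeta(6)+\frac13\, i\pi\,\bigl(S_{3,2}(\omega)-2\,\zeta(5)\bigr)+\frac13\,\zeta(2)\,\mathrm{Li}_4(\omega)+\frac{1}{324}\,(2 i\pi)^3\,\zeta(3). \] -/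

import Mathlib

/-- The classical polylogarithm `Li_m(z) = ∑_{k ≥ 1} z^k / k^m`, given by its power series, which
converges absolutely for `‖z‖ ≤ 1` when `m ≥ 2` (the sum is indexed by `k = j + 1`, `j ≥ 0`). -/
noncomputable def classicalPolylog (m : ℕ) (z : ℂ) : ℂ :=
  ∑' j : ℕ, z ^ (j + 1) / ((j + 1 : ℕ) : ℂ) ^ m

/-- Nielsen's generalised polylogarithm, for `n, p ≥ 1` and `z` outside the cut `(1, ∞)`:
`S_{n,p}(z) = (-1)^(n+p-1) / ((n-1)! p!) * ∫_0^1 log^(n-1)(t) log^p(1 - z t) dt / t`,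
with the principal branch of the logarithm. -/
noncomputable def nielsenPolylog (n p : ℕ) (z : ℂ) : ℂ :=
  (-1 : ℂ) ^ (n + p - 1) / (((n - 1).factorial : ℂ) * (p.factorial : ℂ)) *
    ∫ t in (0 : ℝ)..1, (Real.log t : ℂ) ^ (n - 1) * Complex.log (1 - z * (t : ℂ)) ^ p / (t : ℂ)

/-! Write M_z(i,j) for the integral of log^i t · log^j(1 - zt) dt/t over (0,1) (`logMoment`). Then
S_{n,p}(z) is a rational multiple of M_z(n-1,p), and M_z(i,1) is a multiple of Li_{i+2}(z). Both
identities are linear relations among such moments of weight i + j + 1 = 6, with lower-weight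
moments multiplied by powers of πi/3.

At ω the relations come from Cauchy's theorem (`integral_ray_sub_integral_arc`) for log^i x ·
log^j(1 - x) dx/x, along the interval from 0 to 1, the ray x = ωt, and the arc x = 1/(1 - ωt) from
1. Since 1 - ω = 1/ω, ray and arc both end at ω. On the arc, log x, log(1 - x) and dx/x are
expressed through log t, log(1 - ωt), πi/3 and ω dt/(1 - ωt), so integration by parts returns
moments at ω. In the resulting family `logMoment_sixthRoot_contour`, one combination isolates
S_{3,3}, S_{3,2}, Li_6 and Li_4 at ω against moments at 1, which gives (2). Another cancels every
moment at ω and determines M_1(2,3), the one moment needed below that duality and double zeta values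
do not supply.

At -1 the substitution t = (1 - s)/s turns a suitable combination of moments into an integral over
(1/2,1) that unfolds by s ↔ 1 - s to moments at 1 (`logMoment_neg_one_relation`); with M_1(2,3)
known and Li_6(-1) = -(31/32)ζ(6) this gives (1).

The remaining moments at 1 follow from the duality `logMoment_one_succ` and from Euler's evaluations
of the double zeta values ζ(1,p+1), reached through Tornheim sums. -/

open MeasureTheory Set Filter Topology

/-! ### Calculus of integrals over (0,1) -/

/-- `f` is integrable on the open unit interval with integral `v`. -/
def HasUnitIntegral (f : ℝ → ℂ) (v : ℂ) : Prop :=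
  IntegrableOn f (Ioo 0 1) ∧ ∫ t in Ioo (0 : ℝ) 1, f t = v

namespace HasUnitIntegral

variable {f g : ℝ → ℂ} {v w : ℂ}

theorem add (hf : HasUnitIntegral f v) (hg : HasUnitIntegral g w) :
    HasUnitIntegral (fun t => f t + g t) (v + w) :=
  ⟨hf.1.add hg.1, by rw [integral_add hf.1 hg.1, hf.2, hg.2]⟩

theorem const_mul (hf : HasUnitIntegral f v) (c : ℂ) :
    HasUnitIntegral (fun t => c * f t) (c * v) :=
  ⟨hf.1.const_mul c, by rw [integral_const_mul, hf.2]⟩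

theorem congr (hf : HasUnitIntegral f v) (h : ∀ t ∈ Ioo (0 : ℝ) 1, g t = f t) :
    HasUnitIntegral g v :=
  ⟨hf.1.congr_fun (fun t ht => (h t ht).symm) measurableSet_Ioo,
    (setIntegral_congr_fun measurableSet_Ioo h).trans hf.2⟩

theorem unique (hf : HasUnitIntegral f v) (hg : HasUnitIntegral f w) : v = w :=
  hf.2.symm.trans hg.2

theorem intervalIntegrable (hf : HasUnitIntegral f v) : IntervalIntegrable f volume 0 1 := by
  rw [intervalIntegrable_iff_integrableOn_Ioo_of_le zero_le_one]
  exact hf.1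

theorem intervalIntegral (hf : HasUnitIntegral f v) : ∫ t in (0 : ℝ)..1, f t = v := by
  rw [intervalIntegral.integral_of_le zero_le_one, integral_Ioc_eq_integral_Ioo, hf.2]

theorem of_integrableOn (hf : IntegrableOn f (Ioo 0 1)) :
    HasUnitIntegral f (∫ t in Ioo (0 : ℝ) 1, f t) := ⟨hf, rfl⟩

theorem of_intervalIntegral (hf : IntegrableOn f (Ioo 0 1)) (h : ∫ t in (0 : ℝ)..1, f t = v) :
    HasUnitIntegral f v := by
  refine ⟨hf, ?_⟩
  rw [← h, intervalIntegral.integral_of_le zero_le_one, integral_Ioc_eq_integral_Ioo]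

/-- The fundamental theorem of calculus on the open unit interval. -/
theorem of_hasDerivAt {F : ℝ → ℂ} (hF : ∀ t ∈ Ioo (0 : ℝ) 1, HasDerivAt F (f t) t)
    (hf : IntegrableOn f (Ioo 0 1)) (h0 : Tendsto F (𝓝[>] 0) (𝓝 v))
    (h1 : Tendsto F (𝓝[<] 1) (𝓝 w)) : HasUnitIntegral f (w - v) := by
  refine of_intervalIntegral hf ?_
  refine intervalIntegral.integral_eq_sub_of_hasDerivAt_of_tendsto zero_lt_one hF ?_ h0 h1
  rw [intervalIntegrable_iff_integrableOn_Ioo_of_le zero_le_one]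
  exact hf

/-- Reflection `t ↦ 1 - t`. -/
theorem comp_one_sub (hf : HasUnitIntegral f v) : HasUnitIntegral (fun t => f (1 - t)) v := by
  have hi : IntervalIntegrable (fun t => f (1 - t)) volume 0 1 := by
    simpa using (hf.intervalIntegrable.comp_sub_left 1).symm
  refine of_intervalIntegral ?_ ?_
  · rwa [intervalIntegrable_iff_integrableOn_Ioo_of_le zero_le_one] at hi
  · rw [intervalIntegral.integral_comp_sub_left (fun t => f t) 1]
    simpa using hf.intervalIntegral

end HasUnitIntegral

/-! ### Domination by powers of a logarithmic weight -/

theorem neg_log_nonneg {t : ℝ} (ht : t ∈ Ioo (0 : ℝ) 1) : 0 ≤ -Real.log t :=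
  neg_nonneg.2 (Real.log_nonpos ht.1.le ht.2.le)

theorem one_sub_mem_Ioo {t : ℝ} (ht : t ∈ Ioo (0 : ℝ) 1) : 1 - t ∈ Ioo (0 : ℝ) 1 :=
  ⟨by linarith [ht.2], by linarith [ht.1]⟩

/-- The weight `1 - log t - log (1 - t)`, whose powers dominate all the integrands below. -/
noncomputable def logWeight (t : ℝ) : ℝ := 1 - Real.log t - Real.log (1 - t)

theorem one_le_logWeight {t : ℝ} (ht : t ∈ Ioo (0 : ℝ) 1) : 1 ≤ logWeight t := by
  have h1 := neg_log_nonneg ht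
  have h2 := neg_log_nonneg (one_sub_mem_Ioo ht)
  unfold logWeight; linarith

/-- By w^n ≤ 4^n n! e^{w/4}, a power of the weight costs only (t(1 - t))^{-1/4}. The divisor 4 makes
the squares in AB ≤ A² + B² equal to t^{-1/2} and (1 - t)^{-1/2}, which are integrable. -/
theorem logWeight_pow_le (n : ℕ) {t : ℝ} (ht : t ∈ Ioo (0 : ℝ) 1) :
    logWeight t ^ n ≤ 4 ^ n * n.factorial * Real.exp (1 / 4) *
      (t ^ (-(1 / 2) : ℝ) + (1 - t) ^ (-(1 / 2) : ℝ)) := by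
  have h1 := one_sub_mem_Ioo ht
  have hw := one_le_logWeight ht
  have hexp := Real.pow_div_factorial_le_exp (logWeight t / 4) (by linarith) n
  have hn : (0 : ℝ) < n.factorial := by exact_mod_cast n.factorial_pos
  rw [div_le_iff₀ hn, div_pow, div_le_iff₀ (by positivity)] at hexp
  have he : Real.exp (logWeight t / 4) =
      Real.exp (1 / 4) * (Real.exp (-Real.log t / 4) * Real.exp (-Real.log (1 - t) / 4)) := by
    rw [← Real.exp_add, ← Real.exp_add]; congr 1; unfold logWeight; ring
  have hr : ∀ s : ℝ, 0 < s → s ^ (-(1 / 2) : ℝ) = Real.exp (-Real.log s / 4) ^ 2 := by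
    intro s hs
    rw [Real.rpow_def_of_pos hs, ← Real.exp_nat_mul]; congr 1; push_cast; ring
  rw [hr t ht.1, hr _ h1.1]
  set A := Real.exp (-Real.log t / 4)
  set B := Real.exp (-Real.log (1 - t) / 4)
  have hAB : A * B ≤ A ^ 2 + B ^ 2 := by nlinarith [sq_nonneg (A - B), sq_nonneg (A + B)]
  calc logWeight t ^ n ≤ _ := hexp
    _ = 4 ^ n * n.factorial * Real.exp (1 / 4) * (A * B) := by rw [he]; ring
    _ ≤ _ := by gcongr

theorem integrableOn_logWeight_bound (n : ℕ) :
    IntegrableOn (fun t : ℝ => 4 ^ n * n.factorial * Real.exp (1 / 4) *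
      (t ^ (-(1 / 2) : ℝ) + (1 - t) ^ (-(1 / 2) : ℝ))) (Ioo 0 1) := by
  have h := intervalIntegral.intervalIntegrable_rpow' (a := 0) (b := 1) (r := -(1 / 2))
    (by norm_num)
  have h' : IntervalIntegrable (fun t : ℝ => (1 - t) ^ (-(1 / 2) : ℝ)) volume 0 1 := by
    simpa using (h.comp_sub_left 1).symm
  rw [intervalIntegrable_iff_integrableOn_Ioo_of_le zero_le_one] at h h'
  exact (h.add h').const_mul _

theorem integrableOn_of_le_logWeight {f : ℝ → ℂ} {C : ℝ} (n : ℕ)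
    (hm : AEStronglyMeasurable f (volume.restrict (Ioo 0 1)))
    (hf : ∀ t ∈ Ioo (0 : ℝ) 1, ‖f t‖ ≤ C * logWeight t ^ n) : IntegrableOn f (Ioo 0 1) := by
  refine Integrable.mono' ((integrableOn_logWeight_bound n).const_mul |C|) hm ?_
  refine (ae_restrict_iff' measurableSet_Ioo).2 (Eventually.of_forall fun t ht => ?_)
  have hw := one_le_logWeight ht
  calc ‖f t‖ ≤ C * logWeight t ^ n := hf t ht
    _ ≤ |C| * logWeight t ^ n := by gcongr; exact le_abs_self C
    _ ≤ _ := by gcongr; exact logWeight_pow_le n ht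

theorem norm_mul_ofReal_le {z : ℂ} (hz : ‖z‖ ≤ 1) {t : ℝ} (ht : t ∈ Ioo (0 : ℝ) 1) :
    ‖z * t‖ ≤ t := by
  rw [norm_mul, Complex.norm_real, Real.norm_eq_abs, abs_of_pos ht.1]
  exact mul_le_of_le_one_left ht.1.le hz

/-- The Taylor coefficients of -log(1 - x) are nonnegative, so the series at |z|t ≤ t is majorised
termwise by the series at t. -/
theorem norm_log_one_sub_le_neg_log {z : ℂ} (hz : ‖z‖ ≤ 1) {t : ℝ} (ht : t ∈ Ioo (0 : ℝ) 1) :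
    ‖Complex.log (1 - z * t)‖ ≤ -Real.log (1 - t) := by
  have hzt := norm_mul_ofReal_le hz ht
  have h1 := Complex.hasSum_taylorSeries_neg_log (z := z * t) (hzt.trans_lt ht.2)
  have h2 := Complex.hasSum_taylorSeries_neg_log (z := (t : ℂ))
    (by rw [Complex.norm_real, Real.norm_eq_abs, abs_of_pos ht.1]; exact ht.2)
  have h3 : HasSum (fun n : ℕ => t ^ n / (n : ℝ)) (-Real.log (1 - t)) := by
    have h4 := Complex.hasSum_re h2
    rw [← Complex.ofReal_one, ← Complex.ofReal_sub, ← Complex.ofReal_log (by linarith [ht.2]),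
      ← Complex.ofReal_neg, Complex.ofReal_re] at h4
    refine h4.congr_fun fun n => ?_
    rw [← Complex.ofReal_pow, ← Complex.ofReal_natCast, ← Complex.ofReal_div, Complex.ofReal_re]
  rw [← norm_neg, ← h1.tsum_eq]
  refine tsum_of_norm_bounded h3 fun n => ?_
  rw [norm_div, norm_pow, Complex.norm_natCast]
  gcongr

/-- This is log u ≤ u - 1 at u = 1/(1 - t), multiplied by 1 - t. The extracted factor t absorbs the
pole of dt/t at 0. -/
theorem neg_log_one_sub_le {t : ℝ} (ht : t ∈ Ioo (0 : ℝ) 1) :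
    -Real.log (1 - t) ≤ t * (1 - Real.log (1 - t)) := by
  have h1 := one_sub_mem_Ioo ht
  have h := Real.log_le_sub_one_of_pos (inv_pos.2 h1.1)
  rw [Real.log_inv] at h
  have h2 : (1 - t) * (1 - t)⁻¹ = 1 := mul_inv_cancel₀ h1.1.ne'
  nlinarith [h1.1]

/-! ### Logarithmic moments: integrability and boundary limits -/

/-- The integrand `log^i t · log^j (1 - z t) / t`. -/
noncomputable def logMomentIntegrand (z : ℂ) (i j : ℕ) (t : ℝ) : ℂ :=
  (Real.log t : ℂ) ^ i * Complex.log (1 - z * (t : ℂ)) ^ j / (t : ℂ)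

/-- The moment `∫_0^1 log^i t · log^j (1 - z t) dt / t`. -/
noncomputable def logMoment (z : ℂ) (i j : ℕ) : ℂ :=
  ∫ t in Ioo (0 : ℝ) 1, logMomentIntegrand z i j t

theorem norm_log_le_logWeight {t : ℝ} (ht : t ∈ Ioo (0 : ℝ) 1) :
    ‖(Real.log t : ℂ)‖ ≤ logWeight t := by
  have h1 := neg_log_nonneg ht
  have h2 := neg_log_nonneg (one_sub_mem_Ioo ht)
  rw [Complex.norm_real, Real.norm_eq_abs, abs_of_nonpos (by linarith)]
  unfold logWeight; linarith

theorem norm_log_one_sub_le_logWeight {z : ℂ} (hz : ‖z‖ ≤ 1) {t : ℝ} (ht : t ∈ Ioo (0 : ℝ) 1) :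
    ‖Complex.log (1 - z * t)‖ ≤ logWeight t := by
  have h1 := neg_log_nonneg ht
  have h2 := norm_log_one_sub_le_neg_log hz ht
  unfold logWeight; linarith

theorem norm_log_one_sub_div_le_logWeight {z : ℂ} (hz : ‖z‖ ≤ 1) {t : ℝ}
    (ht : t ∈ Ioo (0 : ℝ) 1) : ‖Complex.log (1 - z * t) / t‖ ≤ logWeight t := by
  have h1 := neg_log_nonneg ht
  have h2 := norm_log_one_sub_le_neg_log hz ht
  have h3 := neg_log_one_sub_le ht
  rw [norm_div, Complex.norm_real, Real.norm_eq_abs, abs_of_pos ht.1, div_le_iff₀ ht.1]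
  have : (1 - Real.log (1 - t)) * t ≤ logWeight t * t := by
    apply mul_le_mul_of_nonneg_right _ ht.1.le
    unfold logWeight; linarith
  linarith

theorem measurable_logMomentIntegrand (z : ℂ) (i j : ℕ) :
    Measurable (logMomentIntegrand z i j) := by
  unfold logMomentIntegrand
  have h1 : Measurable fun t : ℝ => Complex.log (1 - z * (t : ℂ)) :=
    Complex.measurable_log.comp (by fun_prop)
  have h2 : Measurable fun t : ℝ => ((Real.log t : ℝ) : ℂ) :=
    Complex.measurable_ofReal.comp Real.measurable_log
  exact ((h2.pow_const i).mul (h1.pow_const j)).div Complex.measurable_ofReal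

theorem hasUnitIntegral_logMoment {z : ℂ} (hz : ‖z‖ ≤ 1) (i : ℕ) {j : ℕ} (hj : j ≠ 0) :
    HasUnitIntegral (logMomentIntegrand z i j) (logMoment z i j) := by
  obtain ⟨k, rfl⟩ := Nat.exists_eq_succ_of_ne_zero hj
  refine .of_integrableOn (integrableOn_of_le_logWeight (C := 1) (i + k + 1)
    (measurable_logMomentIntegrand z i _).aestronglyMeasurable fun t ht => ?_)
  have hw := one_le_logWeight ht
  have h1 := norm_log_le_logWeight ht
  have h2 := norm_log_one_sub_le_logWeight hz ht
  have h3 := norm_log_one_sub_div_le_logWeight hz ht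
  calc ‖logMomentIntegrand z i (k + 1) t‖
      = ‖(Real.log t : ℂ)‖ ^ i * ‖Complex.log (1 - z * t)‖ ^ k *
          ‖Complex.log (1 - z * t) / t‖ := by
        rw [← norm_pow, ← norm_pow, ← norm_mul, ← norm_mul]
        unfold logMomentIntegrand; congr 1; ring
    _ ≤ logWeight t ^ i * logWeight t ^ k * logWeight t := by gcongr
    _ = 1 * logWeight t ^ (i + k + 1) := by ring

theorem nielsenPolylog_eq_logMoment {z : ℂ} (hz : ‖z‖ ≤ 1) (n : ℕ) {p : ℕ} (hp : p ≠ 0) :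
    nielsenPolylog n p z = (-1 : ℂ) ^ (n + p - 1) /
      (((n - 1).factorial : ℂ) * (p.factorial : ℂ)) * logMoment z (n - 1) p := by
  rw [nielsenPolylog, ← (hasUnitIntegral_logMoment hz (n - 1) hp).intervalIntegral]
  rfl

theorem tendsto_logWeight_pow_mul (n : ℕ) :
    Tendsto (fun t : ℝ => logWeight t ^ n * t) (𝓝[>] 0) (𝓝 0) := by
  have hI : ∀ᶠ t : ℝ in 𝓝[>] 0, t ∈ Ioo (0 : ℝ) 1 := Ioo_mem_nhdsGT zero_lt_one
  have hlim : Tendsto (fun t : ℝ => 4 ^ n * n.factorial * Real.exp (1 / 4) *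
      (t ^ ((1 / 2) : ℝ) + t * (1 - t) ^ (-(1 / 2) : ℝ))) (𝓝[>] 0) (𝓝 0) := by
    have h : ContinuousAt (fun t : ℝ => 4 ^ n * n.factorial * Real.exp (1 / 4) *
      (t ^ ((1 / 2) : ℝ) + t * (1 - t) ^ (-(1 / 2) : ℝ))) 0 := by
      refine continuousAt_const.mul ((Real.continuousAt_rpow_const _ _ (by norm_num)).add
        (continuousAt_id.mul (ContinuousAt.rpow_const (by fun_prop) (by norm_num))))
    have := h.tendsto
    simp only [zero_mul, add_zero] at this
    rw [Real.zero_rpow (by norm_num), mul_zero] at this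
    exact this.mono_left nhdsWithin_le_nhds
  refine squeeze_zero' (hI.mono fun t ht => ?_) (hI.mono fun t ht => ?_) hlim
  · have := one_le_logWeight ht
    have := ht.1
    positivity
  · calc logWeight t ^ n * t ≤ _ := mul_le_mul_of_nonneg_right (logWeight_pow_le n ht) ht.1.le
      _ = _ := by
        have : t ^ ((1 / 2) : ℝ) = t ^ (-(1 / 2) : ℝ) * t := by
          nth_rewrite 3 [← Real.rpow_one t]
          rw [← Real.rpow_add ht.1]; norm_num
        rw [this]; ring

theorem logWeight_one_sub (t : ℝ) : logWeight (1 - t) = logWeight t := by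
  unfold logWeight; rw [sub_sub_cancel]; ring

theorem tendsto_one_sub_nhdsLT_one : Tendsto (fun t : ℝ => 1 - t) (𝓝[<] 1) (𝓝[>] 0) := by
  refine tendsto_nhdsWithin_iff.2 ⟨?_, ?_⟩
  · have : Tendsto (fun t : ℝ => 1 - t) (𝓝 1) (𝓝 (1 - 1)) :=
      Continuous.tendsto (by fun_prop) 1
    rw [sub_self] at this
    exact this.mono_left nhdsWithin_le_nhds
  · filter_upwards [self_mem_nhdsWithin] with t ht
    simpa using ht

theorem tendsto_logWeight_pow_mul_one_sub (n : ℕ) :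
    Tendsto (fun t : ℝ => logWeight t ^ n * (1 - t)) (𝓝[<] 1) (𝓝 0) := by
  refine ((tendsto_logWeight_pow_mul n).comp tendsto_one_sub_nhdsLT_one).congr fun t => ?_
  simp [logWeight_one_sub]

theorem norm_log_one_sub_le_mul_logWeight {z : ℂ} (hz : ‖z‖ ≤ 1) {t : ℝ}
    (ht : t ∈ Ioo (0 : ℝ) 1) : ‖Complex.log (1 - z * t)‖ ≤ t * logWeight t := by
  have h := norm_log_one_sub_div_le_logWeight hz ht
  rw [norm_div, Complex.norm_real, Real.norm_eq_abs, abs_of_pos ht.1, div_le_iff₀ ht.1] at h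
  linarith

theorem norm_log_le_mul_logWeight {t : ℝ} (ht : t ∈ Ioo (0 : ℝ) 1) :
    ‖(Real.log t : ℂ)‖ ≤ (1 - t) * logWeight t := by
  have h := norm_log_one_sub_le_mul_logWeight (z := 1) (by simp) (one_sub_mem_Ioo ht)
  rw [logWeight_one_sub] at h
  rw [Complex.ofReal_log ht.1.le]
  simpa using h

theorem tendsto_log_pow_mul_log_one_sub_pow {z : ℂ} (hz : ‖z‖ ≤ 1) (i j : ℕ) :
    Tendsto (fun t : ℝ => (Real.log t : ℂ) ^ i * Complex.log (1 - z * t) ^ (j + 1))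
      (𝓝[>] 0) (𝓝 0) := by
  have hI : ∀ᶠ t : ℝ in 𝓝[>] 0, t ∈ Ioo (0 : ℝ) 1 := Ioo_mem_nhdsGT zero_lt_one
  refine squeeze_zero_norm' (hI.mono fun t ht => ?_) (tendsto_logWeight_pow_mul (i + j + 1))
  have hw := one_le_logWeight ht
  have := ht.1.le
  calc ‖(Real.log t : ℂ) ^ i * Complex.log (1 - z * t) ^ (j + 1)‖
      = ‖(Real.log t : ℂ)‖ ^ i * ‖Complex.log (1 - z * t)‖ ^ j * ‖Complex.log (1 - z * t)‖ := by
        rw [norm_mul, norm_pow, norm_pow]; ring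
    _ ≤ logWeight t ^ i * logWeight t ^ j * (t * logWeight t) := by
        gcongr
        · exact norm_log_le_logWeight ht
        · exact norm_log_one_sub_le_logWeight hz ht
        · exact norm_log_one_sub_le_mul_logWeight hz ht
    _ = _ := by ring

/-! ### Integration by parts and duality at 1 -/

theorem one_sub_mul_mem_slitPlane {z : ℂ} (hz : ‖z‖ ≤ 1) {t : ℝ} (ht : t ∈ Ioo (0 : ℝ) 1) :
    1 - z * t ∈ Complex.slitPlane := by
  refine Or.inl ?_
  have h1 := Complex.re_le_norm (z * t)
  have h2 := norm_mul_ofReal_le hz ht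
  rw [Complex.sub_re, Complex.one_re]
  linarith [ht.2]

theorem hasDerivAt_log_one_sub_mul {z : ℂ} {t : ℝ} (h : 1 - z * t ∈ Complex.slitPlane) :
    HasDerivAt (fun t : ℝ => Complex.log (1 - z * t)) (-z / (1 - z * t)) t := by
  have h1 : HasDerivAt (fun t : ℝ => 1 - z * (t : ℂ)) (-z) t := by
    simpa using ((Complex.ofRealCLM.hasDerivAt (x := t)).const_mul z).const_sub 1
  exact h1.clog_real h

theorem hasDerivAt_ofReal_log {t : ℝ} (ht : t ≠ 0) :
    HasDerivAt (fun t : ℝ => (Real.log t : ℂ)) (1 / t) t := by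
  simpa using (Real.hasDerivAt_log ht).ofReal_comp

theorem hasDerivAt_log_pow_mul_log_one_sub_pow {z : ℂ} {t : ℝ} (ht : t ≠ 0)
    (h : 1 - z * t ∈ Complex.slitPlane) (i j : ℕ) :
    HasDerivAt (fun t : ℝ => (Real.log t : ℂ) ^ (i + 1) * Complex.log (1 - z * t) ^ (j + 1))
      ((i + 1) * logMomentIntegrand z i (j + 1) t +
        (-(j + 1)) * ((Real.log t : ℂ) ^ (i + 1) * Complex.log (1 - z * t) ^ j *
          (z / (1 - z * t)))) t := by
  have h1 := ((hasDerivAt_ofReal_log ht).pow (i + 1)).mul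
    ((hasDerivAt_log_one_sub_mul h).pow (j + 1))
  refine h1.congr_deriv ?_
  simp only [Pi.pow_apply, Nat.add_sub_cancel]
  unfold logMomentIntegrand
  push_cast
  ring

/-- Integration by parts combined with `t ↦ 1 - t`. -/
theorem logMoment_one_succ (i j : ℕ) :
    (i + 1) * logMoment 1 i (j + 1) = (j + 1) * logMoment 1 j (i + 1) := by
  have hz : ‖(1 : ℂ)‖ ≤ 1 := by simp
  have h1 := hasUnitIntegral_logMoment hz i (Nat.add_one_ne_zero j)
  -- After t ↦ 1 - t this integrand is log^{i+1} t · log^j(1 - t)/(1 - t), the other half of the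
  -- derivative of log^{i+1} t · log^{j+1}(1 - t). The boundary values of that product vanish at
  -- both ends.
  have h2 := (hasUnitIntegral_logMoment hz j (Nat.add_one_ne_zero i)).comp_one_sub
  have h3 := (h1.const_mul (i + 1)).add (h2.const_mul (-(j + 1)))
  have hlim : Tendsto (fun t : ℝ => (Real.log t : ℂ) ^ (i + 1) *
      Complex.log (1 - 1 * t) ^ (j + 1)) (𝓝[<] 1) (𝓝 0) := by
    have hI : ∀ᶠ t : ℝ in 𝓝[<] 1, t ∈ Ioo (0 : ℝ) 1 := Ioo_mem_nhdsLT zero_lt_one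
    refine squeeze_zero_norm' (hI.mono fun t ht => ?_)
      (tendsto_logWeight_pow_mul_one_sub (i + (j + 1) + 1))
    have hw := one_le_logWeight ht
    have := (one_sub_mem_Ioo ht).1.le
    calc _ = ‖(Real.log t : ℂ)‖ ^ i * ‖Complex.log (1 - 1 * t)‖ ^ (j + 1) *
            ‖(Real.log t : ℂ)‖ := by
          rw [norm_mul, norm_pow, norm_pow]; ring
      _ ≤ logWeight t ^ i * logWeight t ^ (j + 1) * ((1 - t) * logWeight t) := by
          gcongr
          · exact norm_log_le_logWeight ht
          · exact norm_log_one_sub_le_logWeight hz ht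
          · exact norm_log_le_mul_logWeight ht
      _ = _ := by ring
  have h4 := h3.congr (g := fun t : ℝ => (i + 1) * logMomentIntegrand 1 i (j + 1) t +
        (-(j + 1)) * ((Real.log t : ℂ) ^ (i + 1) * Complex.log (1 - 1 * t) ^ j *
          (1 / (1 - 1 * t)))) ?_
  · have h5 := HasUnitIntegral.of_hasDerivAt (fun t ht => hasDerivAt_log_pow_mul_log_one_sub_pow
      ht.1.ne' (one_sub_mul_mem_slitPlane hz ht) i j) h4.1
      (tendsto_log_pow_mul_log_one_sub_pow hz (i + 1) j) hlim
    linear_combination h4.unique h5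
  · intro t ht
    have h1t := one_sub_mem_Ioo ht
    simp only [logMomentIntegrand, one_mul]
    rw [Complex.ofReal_log h1t.1.le, Complex.ofReal_log ht.1.le]
    push_cast
    rw [sub_sub_cancel]
    ring

/-- Keeps 1 - zt uniformly away from 0 up to t = 1, so that z/(1 - zt) is bounded. The value 1/2 is
sharp for ω. -/
theorem half_le_re_one_sub_mul {z : ℂ} (hr : z.re ≤ 1 / 2) {t : ℝ} (ht : t ∈ Icc (0 : ℝ) 1) :
    1 / 2 ≤ (1 - z * t).re := by
  simp only [Complex.sub_re, Complex.one_re, Complex.mul_re, Complex.ofReal_re,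
    Complex.ofReal_im, mul_zero, sub_zero]
  rcases le_total z.re 0 with h | h <;> nlinarith [ht.1, ht.2]

theorem integrableOn_dlog {z : ℂ} (hz : ‖z‖ ≤ 1) (hr : z.re ≤ 1 / 2) (i j : ℕ) :
    IntegrableOn (fun t : ℝ => (Real.log t : ℂ) ^ i * Complex.log (1 - z * t) ^ j *
      (z / (1 - z * t))) (Ioo 0 1) := by
  refine integrableOn_of_le_logWeight (C := 2) (i + j) ?_ fun t ht => ?_
  · have h1 : Measurable fun t : ℝ => Complex.log (1 - z * (t : ℂ)) :=
      Complex.measurable_log.comp (by fun_prop)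
    have h2 : Measurable fun t : ℝ => ((Real.log t : ℝ) : ℂ) :=
      Complex.measurable_ofReal.comp Real.measurable_log
    have h3 : Measurable fun t : ℝ => z / (1 - z * (t : ℂ)) := by fun_prop
    exact (((h2.pow_const i).mul (h1.pow_const j)).mul h3).aestronglyMeasurable
  · have hw := one_le_logWeight ht
    have hb : ‖z / (1 - z * t)‖ ≤ 2 := by
      have h1 := half_le_re_one_sub_mul hr (Ioo_subset_Icc_self ht)
      have h2 := Complex.re_le_norm (1 - z * t)
      rw [norm_div, div_le_iff₀ (by linarith)]
      linarith
    rw [norm_mul, norm_mul, norm_pow, norm_pow]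
    calc _ ≤ logWeight t ^ i * logWeight t ^ j * 2 := by
          gcongr
          · exact norm_log_le_logWeight ht
          · exact norm_log_one_sub_le_logWeight hz ht
      _ = _ := by ring

theorem continuousAt_log_one_sub_mul {z : ℂ} (hr : z.re ≤ 1 / 2) :
    ContinuousAt (fun t : ℝ => Complex.log (1 - z * t)) 1 := by
  have h := half_le_re_one_sub_mul hr (t := 1) (by simp)
  have hs : 1 - z * ((1 : ℝ) : ℂ) ∈ Complex.slitPlane := Or.inl (by linarith)
  exact (hasDerivAt_log_one_sub_mul hs).continuousAt

/-- Integration by parts for `log^i t · log^j (1 - z t) · z dt / (1 - z t)`, with `i ≥ 1`. -/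
theorem hasUnitIntegral_dlog_succ {z : ℂ} (hz : ‖z‖ ≤ 1) (hr : z.re ≤ 1 / 2) (i j : ℕ) :
    HasUnitIntegral (fun t : ℝ => (Real.log t : ℂ) ^ (i + 1) * Complex.log (1 - z * t) ^ j *
      (z / (1 - z * t))) ((i + 1) / (j + 1) * logMoment z i (j + 1)) := by
  have h1 := hasUnitIntegral_logMoment hz i (Nat.add_one_ne_zero j)
  have h2 := HasUnitIntegral.of_integrableOn (integrableOn_dlog hz hr (i + 1) j)
  have h3 := (h1.const_mul (i + 1)).add (h2.const_mul (-(j + 1)))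
  have hlim : Tendsto (fun t : ℝ => (Real.log t : ℂ) ^ (i + 1) *
      Complex.log (1 - z * t) ^ (j + 1)) (𝓝[<] 1) (𝓝 0) := by
    have hc := ((hasDerivAt_ofReal_log one_ne_zero).continuousAt.pow (i + 1)).mul
      ((continuousAt_log_one_sub_mul hr).pow (j + 1))
    refine (hc.tendsto.mono_left nhdsWithin_le_nhds).trans_eq ?_
    simp
  have h5 := HasUnitIntegral.of_hasDerivAt (fun t ht => hasDerivAt_log_pow_mul_log_one_sub_pow
      ht.1.ne' (one_sub_mul_mem_slitPlane hz ht) i j) h3.1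
      (tendsto_log_pow_mul_log_one_sub_pow hz (i + 1) j) hlim
  have h6 := h3.unique h5
  have hj : (j : ℂ) + 1 ≠ 0 := by exact_mod_cast j.succ_ne_zero
  refine ⟨h2.1, ?_⟩
  rw [div_mul_eq_mul_div, eq_div_iff hj]
  linear_combination -h6

theorem hasUnitIntegral_dlog_zero {z : ℂ} (hz : ‖z‖ ≤ 1) (hr : z.re ≤ 1 / 2) (j : ℕ) :
    HasUnitIntegral (fun t : ℝ => Complex.log (1 - z * t) ^ j * (z / (1 - z * t)))
      (-Complex.log (1 - z) ^ (j + 1) / (j + 1)) := by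
  have h2 : IntegrableOn (fun t : ℝ => Complex.log (1 - z * t) ^ j * (z / (1 - z * t)))
    (Ioo 0 1) := by simpa using integrableOn_dlog hz hr 0 j
  have hj : (j : ℂ) + 1 ≠ 0 := by exact_mod_cast j.succ_ne_zero
  have h5 := HasUnitIntegral.of_hasDerivAt
    (F := fun t : ℝ => -Complex.log (1 - z * t) ^ (j + 1) / (j + 1))
    (fun t ht => ?_) h2 (v := 0) (w := -Complex.log (1 - z) ^ (j + 1) / (j + 1)) ?_ ?_
  · simpa using h5
  · refine (((hasDerivAt_log_one_sub_mul (one_sub_mul_mem_slitPlane hz ht)).pow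
      (j + 1)).neg.div_const ((j : ℂ) + 1)).congr_deriv ?_
    simp only [Nat.add_sub_cancel]
    push_cast
    field_simp
  · simpa using (tendsto_log_pow_mul_log_one_sub_pow hz 0 j).neg.div_const ((j : ℂ) + 1)
  · have := (((continuousAt_log_one_sub_mul hr).pow (j + 1)).neg.div_const ((j : ℂ) + 1)).tendsto
    simp only [Pi.neg_apply, Pi.pow_apply, Complex.ofReal_one, mul_one] at this
    exact this.mono_left nhdsWithin_le_nhds

/-! ### Series expansion of moments: polylogarithms and zeta values -/

theorem norm_log_pow_mul_pow_le (n k : ℕ) {t : ℝ} (ht : t ∈ Ioo (0 : ℝ) 1) :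
    ‖(Real.log t : ℂ) ^ n * (t : ℂ) ^ k‖ ≤ logWeight t ^ n * t ^ k := by
  have := ht.1.le
  rw [norm_mul, norm_pow, norm_pow, Complex.norm_of_nonneg ht.1.le]
  gcongr
  exact norm_log_le_logWeight ht

theorem integrableOn_log_pow_mul_pow (n k : ℕ) :
    IntegrableOn (fun t : ℝ => (Real.log t : ℂ) ^ n * (t : ℂ) ^ k) (Ioo 0 1) := by
  refine integrableOn_of_le_logWeight (C := 1) n ?_ fun t ht => ?_
  · have h2 : Measurable fun t : ℝ => ((Real.log t : ℝ) : ℂ) :=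
      Complex.measurable_ofReal.comp Real.measurable_log
    exact ((h2.pow_const n).mul (Complex.measurable_ofReal.pow_const k)).aestronglyMeasurable
  · refine (norm_log_pow_mul_pow_le n k ht).trans ?_
    have hw := one_le_logWeight ht
    rw [mul_comm]
    gcongr
    exact pow_le_one₀ ht.1.le ht.2.le

theorem hasUnitIntegral_log_pow_mul_pow (n k : ℕ) :
    HasUnitIntegral (fun t : ℝ => (Real.log t : ℂ) ^ n * (t : ℂ) ^ k)
      ((-1) ^ n * n.factorial / (k + 1) ^ (n + 1)) := by
  have hk : (k : ℂ) + 1 ≠ 0 := by exact_mod_cast k.succ_ne_zero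
  induction n with
  | zero =>
    refine .of_intervalIntegral (integrableOn_log_pow_mul_pow 0 k) ?_
    have := integral_pow (a := 0) (b := 1) k
    simp only [pow_zero, one_mul]
    simp_rw [← Complex.ofReal_pow]
    rw [intervalIntegral.integral_ofReal, this]
    simp
  | succ n ih =>
    have h2 := HasUnitIntegral.of_integrableOn (integrableOn_log_pow_mul_pow (n + 1) k)
    have h3 := (ih.const_mul (n + 1)).add (h2.const_mul (k + 1))
    have h5 := HasUnitIntegral.of_hasDerivAt
      (F := fun t : ℝ => (Real.log t : ℂ) ^ (n + 1) * (t : ℂ) ^ (k + 1)) (fun t ht => ?_) h3.1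
      (v := 0) (w := 0) ?_ ?_
    · have h6 := h3.unique h5
      refine ⟨h2.1, ?_⟩
      rw [eq_div_iff (pow_ne_zero _ hk)]
      rw [sub_zero] at h6
      have h7 : ((k : ℂ) + 1) * (∫ t in Ioo (0 : ℝ) 1, (Real.log t : ℂ) ^ (n + 1) * (t : ℂ) ^ k) =
          -((n + 1) * ((-1) ^ n * n.factorial / (k + 1) ^ (n + 1))) := by linear_combination h6
      rw [pow_succ' _ (n + 1), ← mul_assoc, mul_comm _ ((k : ℂ) + 1), h7, Nat.factorial_succ]
      push_cast
      field_simp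
      ring
    · have := ((hasDerivAt_ofReal_log ht.1.ne').pow (n + 1)).mul
        (((Complex.ofRealCLM.hasDerivAt (x := t))).pow (k + 1))
      refine this.congr_deriv ?_
      have ht0 : (t : ℂ) ≠ 0 := by exact_mod_cast ht.1.ne'
      simp only [Pi.pow_apply, Nat.add_sub_cancel, Complex.ofRealCLM_apply, Complex.ofReal_one]
      push_cast
      field_simp
      ring
    · have hI : ∀ᶠ t : ℝ in 𝓝[>] 0, t ∈ Ioo (0 : ℝ) 1 := Ioo_mem_nhdsGT zero_lt_one
      refine squeeze_zero_norm' (hI.mono fun t ht => ?_) (tendsto_logWeight_pow_mul (n + 1))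
      refine (norm_log_pow_mul_pow_le (n + 1) (k + 1) ht).trans ?_
      have hw := one_le_logWeight ht
      gcongr
      rw [pow_succ]
      exact mul_le_of_le_one_left ht.1.le (pow_le_one₀ ht.1.le ht.2.le)
    · have hc := ((hasDerivAt_ofReal_log one_ne_zero).continuousAt.pow (n + 1)).mul
        (Complex.continuous_ofReal.continuousAt.pow (k + 1))
      refine (hc.tendsto.mono_left nhdsWithin_le_nhds).trans_eq ?_
      simp

theorem integral_norm_const_mul_log_pow_mul_pow (c : ℂ) (n k : ℕ) :
    ∫ t in Ioo (0 : ℝ) 1, ‖c * ((Real.log t : ℂ) ^ n * (t : ℂ) ^ k)‖ =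
      ‖c‖ * (n.factorial / (k + 1) ^ (n + 1)) := by
  have h := ((hasUnitIntegral_log_pow_mul_pow n k).const_mul ((-1) ^ n * ‖c‖)).congr
    (g := fun t : ℝ => ((‖c * ((Real.log t : ℂ) ^ n * (t : ℂ) ^ k)‖ : ℝ) : ℂ)) fun t ht => by
      have h1 : ‖(Real.log t : ℂ)‖ = -Real.log t := by
        rw [Complex.norm_real, Real.norm_eq_abs, abs_of_nonpos (by linarith [neg_log_nonneg ht])]
      rw [norm_mul, norm_mul, norm_pow, norm_pow, Complex.norm_of_nonneg ht.1.le, h1, neg_pow]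
      push_cast
      ring
  have h2 := integral_ofReal.symm.trans h.2
  have h1 : ((-1 : ℂ) ^ n) * (-1) ^ n = 1 := by rw [← mul_pow]; simp
  apply Complex.ofReal_injective
  refine h2.trans ?_
  push_cast
  linear_combination (‖c‖ * (n.factorial / (k + 1) ^ (n + 1)) : ℂ) * h1

/-- Expand log(1 - zt) and integrate termwise. The integrals of the norms are at most i!/(k + 1)²,
so summation and integration commute even when |z| = 1. -/
theorem hasSum_logMoment_one {z : ℂ} (hz : ‖z‖ ≤ 1) (i : ℕ) :
    HasSum (fun k : ℕ => -(z ^ (k + 1) / (k + 1)) *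
      ((-1) ^ i * i.factorial / ((k : ℂ) + 1) ^ (i + 1))) (logMoment z i 1) := by
  have h := hasSum_integral_of_summable_integral_norm (μ := volume.restrict (Ioo (0 : ℝ) 1))
    (F := fun (k : ℕ) (t : ℝ) =>
      -(z ^ (k + 1) / (k + 1)) * ((Real.log t : ℂ) ^ i * (t : ℂ) ^ k))
    (fun k => (integrableOn_log_pow_mul_pow i k).const_mul _) ?_
  · have h2 : ∫ t in Ioo (0 : ℝ) 1, ∑' k : ℕ,
        -(z ^ (k + 1) / (k + 1)) * ((Real.log t : ℂ) ^ i * (t : ℂ) ^ k) = logMoment z i 1 := by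
      refine setIntegral_congr_fun measurableSet_Ioo fun t ht => ?_
      have h3 := Complex.hasSum_taylorSeries_neg_log (z := z * t)
        ((norm_mul_ofReal_le hz ht).trans_lt ht.2)
      rw [← hasSum_nat_add_iff' 1] at h3
      have ht0 : (t : ℂ) ≠ 0 := by exact_mod_cast ht.1.ne'
      have h4 := (h3.mul_left (-(Real.log t : ℂ) ^ i / t)).tsum_eq
      simp only [Finset.sum_range_one, pow_zero, Nat.cast_zero, div_zero, sub_zero] at h4
      simp only [logMomentIntegrand, pow_one]
      calc _ = _ := tsum_congr fun k => ?_
        _ = _ := h4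
        _ = _ := by ring
      have hk : (k : ℂ) + 1 ≠ 0 := by exact_mod_cast k.succ_ne_zero
      push_cast
      rw [mul_pow]
      field_simp
      ring
    rw [h2] at h
    refine h.congr_fun fun k => ?_
    rw [integral_const_mul, (hasUnitIntegral_log_pow_mul_pow i k).2]
  · simp_rw [integral_norm_const_mul_log_pow_mul_pow]
    have h1 : Summable fun k : ℕ => i.factorial * (1 / ((k + 1 : ℕ) : ℝ) ^ 2) :=
      ((summable_nat_add_iff 1).2 (Real.summable_one_div_nat_pow.2 one_lt_two)).mul_left _
    refine h1.of_nonneg_of_le (fun k => by positivity) fun k => ?_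
    rw [norm_neg, norm_div, norm_pow]
    have h2 : ‖(k : ℂ) + 1‖ = k + 1 := by
      rw [← Nat.cast_add_one, Complex.norm_natCast]; push_cast; rfl
    have h3 : ‖z‖ ^ (k + 1) ≤ 1 := pow_le_one₀ (norm_nonneg _) hz
    rw [h2]
    have h4 : ((k : ℝ) + 1) ≤ (k + 1) ^ (i + 1) := by
      refine le_self_pow₀ (by linarith [k.cast_nonneg (α := ℝ)]) (Nat.succ_ne_zero i)
    calc ‖z‖ ^ (k + 1) / ((k : ℝ) + 1) * (i.factorial / ((k : ℝ) + 1) ^ (i + 1))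
        ≤ 1 / ((k : ℝ) + 1) * (i.factorial / (k + 1)) := by gcongr
      _ = _ := by push_cast; field_simp

theorem logMoment_one_eq_classicalPolylog {z : ℂ} (hz : ‖z‖ ≤ 1) (i : ℕ) :
    logMoment z i 1 = -((-1) ^ i * i.factorial) * classicalPolylog (i + 2) z := by
  rw [← (hasSum_logMoment_one hz i).tsum_eq, classicalPolylog, ← tsum_mul_left]
  refine tsum_congr fun k => ?_
  have hk : (k : ℂ) + 1 ≠ 0 := by exact_mod_cast k.succ_ne_zero
  push_cast
  field_simp
  ring

theorem classicalPolylog_one (i : ℕ) : classicalPolylog (i + 2) 1 = riemannZeta (i + 2 : ℕ) := by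
  rw [zeta_nat_eq_tsum_of_gt_one (by omega), classicalPolylog]
  have h : Summable fun n : ℕ => 1 / (n : ℂ) ^ (i + 2) :=
    .of_norm (by simp)
  rw [h.tsum_eq_zero_add]
  simp

theorem logMoment_one_one (i : ℕ) :
    logMoment 1 i 1 = -((-1) ^ i * i.factorial) * riemannZeta (i + 2 : ℕ) := by
  rw [logMoment_one_eq_classicalPolylog (by simp), classicalPolylog_one]

/-! ### Tornheim sums as moments at 1 -/

/-- The general term of Tornheim's double series with exponents `1, 1, p`. -/
noncomputable def tornheimTerm (p : ℕ) (x : ℕ × ℕ) : ℝ :=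
  1 / (((x.1 : ℝ) + 1) * (x.2 + 1) * (x.1 + x.2 + 2) ^ p)

/-- Since (n + m + 2)^p ≥ √(n + 1) · √(m + 1), the term is at most a product of two convergent
3/2-series. -/
theorem summable_tornheimTerm {p : ℕ} (hp : p ≠ 0) : Summable (tornheimTerm p) := by
  have h1 : Summable fun k : ℕ => 1 / ((k : ℝ) + 1) ^ (3 / 2 : ℝ) := by
    have := (summable_nat_add_iff 1).2 (Real.summable_one_div_nat_rpow.2
      (show (1 : ℝ) < 3 / 2 by norm_num))
    simpa using this
  have h2 := h1.mul_of_nonneg h1 (fun k => by positivity) (fun k => by positivity)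
  refine h2.of_nonneg_of_le (fun x => by unfold tornheimTerm; positivity) fun x => ?_
  obtain ⟨n, m⟩ := x
  have hs : ∀ k : ℕ, ((k : ℝ) + 1) ^ (3 / 2 : ℝ) = (k + 1) * Real.sqrt (k + 1) := fun k => by
    rw [Real.sqrt_eq_rpow]
    nth_rewrite 2 [← Real.rpow_one ((k : ℝ) + 1)]
    rw [← Real.rpow_add (by positivity)]; norm_num
  simp only [tornheimTerm]
  rw [hs, hs, ← one_div_mul_one_div_rev, mul_comm (1 / _), one_div_mul_one_div_rev,
    one_div_mul_one_div_rev]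
  have h3 : ((n : ℝ) + m + 2) ≤ (n + m + 2) ^ p :=
    le_self_pow₀ (by linarith [n.cast_nonneg (α := ℝ), m.cast_nonneg (α := ℝ)]) hp
  have h4 := Real.sq_sqrt (show (0 : ℝ) ≤ n + 1 by positivity)
  have h5 := Real.sq_sqrt (show (0 : ℝ) ≤ m + 1 by positivity)
  have h6 : Real.sqrt (n + 1) * Real.sqrt (m + 1) ≤ n + m + 2 := by
    nlinarith [sq_nonneg (Real.sqrt (n + 1) - Real.sqrt (m + 1)), Real.sqrt_nonneg ((n : ℝ) + 1),
      Real.sqrt_nonneg ((m : ℝ) + 1)]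
  apply one_div_le_one_div_of_le (by positivity)
  calc _ = ((n : ℝ) + 1) * (m + 1) * (Real.sqrt (n + 1) * Real.sqrt (m + 1)) := by ring
    _ ≤ ((n : ℝ) + 1) * (m + 1) * (n + m + 2) ^ p :=
        mul_le_mul_of_nonneg_left (h6.trans h3) (by positivity)
    _ = _ := by ring

theorem HasSum.mul_self_of_summable_norm {f : ℕ → ℂ} {a : ℂ} (h : HasSum f a)
    (hn : Summable fun n => ‖f n‖) : HasSum (fun x : ℕ × ℕ => f x.1 * f x.2) (a * a) :=
  h.mul h (summable_mul_of_summable_norm hn hn)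

theorem hasSum_log_one_sub_sq_div {t : ℂ} (ht : ‖t‖ < 1) (ht0 : t ≠ 0) :
    HasSum (fun x : ℕ × ℕ => (1 / ((x.1 + 1) * (x.2 + 1)) : ℂ) * t ^ (x.1 + x.2 + 1))
      (Complex.log (1 - t) ^ 2 / t) := by
  have h3 := Complex.hasSum_taylorSeries_neg_log ht
  have h3n := h3.summable.norm
  rw [← hasSum_nat_add_iff' 1] at h3
  rw [← summable_nat_add_iff 1] at h3n
  simp only [Finset.sum_range_one, pow_zero, Nat.cast_zero, div_zero, sub_zero] at h3
  have h5 := (h3.mul_self_of_summable_norm h3n).mul_left (1 / t)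
  rw [neg_mul_neg, ← sq, one_div_mul_eq_div] at h5
  refine h5.congr_fun fun x => ?_
  have hk : (x.1 : ℂ) + 1 ≠ 0 := by exact_mod_cast x.1.succ_ne_zero
  have hk' : (x.2 : ℂ) + 1 ≠ 0 := by exact_mod_cast x.2.succ_ne_zero
  push_cast
  rw [pow_succ t x.1, pow_succ t x.2, pow_succ, pow_add]
  generalize (x.1 : ℂ) + 1 = a, (x.2 : ℂ) + 1 = b, t ^ x.1 = c, t ^ x.2 = d at *
  field_simp

/-- Squaring the series of log(1 - t) gives a double series in t^{n+m+1} after division by t; each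
term integrates against log^i t in closed form. -/
theorem logMoment_one_two (i : ℕ) :
    logMoment 1 i 2 = (-1) ^ i * i.factorial * ((∑' x, tornheimTerm (i + 1) x : ℝ) : ℂ) := by
  have h := hasSum_integral_of_summable_integral_norm (μ := volume.restrict (Ioo (0 : ℝ) 1))
    (F := fun (x : ℕ × ℕ) (t : ℝ) =>
      (1 / ((x.1 + 1) * (x.2 + 1)) : ℂ) * ((Real.log t : ℂ) ^ i * (t : ℂ) ^ (x.1 + x.2 + 1)))
    (fun x => (integrableOn_log_pow_mul_pow i _).const_mul _) ?_
  · have h2 : ∫ t in Ioo (0 : ℝ) 1, ∑' x : ℕ × ℕ,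
        (1 / ((x.1 + 1) * (x.2 + 1)) : ℂ) * ((Real.log t : ℂ) ^ i * (t : ℂ) ^ (x.1 + x.2 + 1))
        = logMoment 1 i 2 := by
      refine setIntegral_congr_fun measurableSet_Ioo fun t ht => ?_
      have ht1 : ‖(t : ℂ)‖ < 1 := by rw [Complex.norm_of_nonneg ht.1.le]; exact ht.2
      have ht0 : (t : ℂ) ≠ 0 := by exact_mod_cast ht.1.ne'
      have h4 := ((hasSum_log_one_sub_sq_div ht1 ht0).mul_left ((Real.log t : ℂ) ^ i)).tsum_eq
      simp only [logMomentIntegrand, one_mul]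
      rw [mul_div_assoc, ← h4]
      exact tsum_congr fun x => by ring
    rw [h2] at h
    rw [← h.tsum_eq, Complex.ofReal_tsum, ← tsum_mul_left]
    refine tsum_congr fun x => ?_
    rw [integral_const_mul, (hasUnitIntegral_log_pow_mul_pow i _).2, tornheimTerm]
    push_cast
    rw [show (x.1 : ℂ) + x.2 + 1 + 1 = x.1 + x.2 + 2 by ring]
    generalize (x.1 : ℂ) + 1 = a, (x.2 : ℂ) + 1 = b, (x.1 : ℂ) + x.2 + 2 = d
    ring
  · simp_rw [integral_norm_const_mul_log_pow_mul_pow]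
    refine ((summable_tornheimTerm i.succ_ne_zero).mul_left (i.factorial : ℝ)).congr fun x => ?_
    have h2 : ∀ k : ℕ, ‖(k : ℂ) + 1‖ = k + 1 := fun k => by
      rw [← Nat.cast_add_one, Complex.norm_natCast]; push_cast; rfl
    rw [norm_div, norm_mul, h2, h2, norm_one, tornheimTerm]
    push_cast
    rw [show (x.1 : ℝ) + x.2 + 1 + 1 = x.1 + x.2 + 2 by ring]
    generalize (x.1 : ℝ) + 1 = a, (x.2 : ℝ) + 1 = b, (x.1 : ℝ) + x.2 + 2 = d
    rw [Nat.succ_eq_add_one]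
    ring

/-! ### Double zeta values and Euler's evaluations -/

/-- `∑ 1 / n^s` over positive integers, as a real number. -/
noncomputable def realZeta (s : ℕ) : ℝ := ∑' n : ℕ, 1 / ((n : ℝ) + 1) ^ s

/-- The general term of the double zeta value `∑_{n < N} 1 / (n^a N^b)`. -/
noncomputable def doubleZetaTerm (a b : ℕ) (x : ℕ × ℕ) : ℝ :=
  1 / (((x.1 : ℝ) + 1) ^ a * (x.1 + x.2 + 2) ^ b)

/-- The double zeta value `∑_{n < N} 1 / (n^a N^b)`. -/
noncomputable def doubleZeta (a b : ℕ) : ℝ := ∑' x, doubleZetaTerm a b x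

/-- The general term of Tornheim's double series with exponents `a, 1, c`. -/
noncomputable def mixedTerm (a c : ℕ) (x : ℕ × ℕ) : ℝ :=
  1 / (((x.1 : ℝ) + 1) ^ a * (x.2 + 1) * (x.1 + x.2 + 2) ^ c)

theorem hasSum_realZeta {s : ℕ} (hs : 1 < s) :
    HasSum (fun n : ℕ => 1 / ((n : ℝ) + 1) ^ s) (realZeta s) := by
  have := (summable_nat_add_iff 1).2 (Real.summable_one_div_nat_pow.2 hs)
  simp only [Nat.cast_add, Nat.cast_one] at this
  exact this.hasSum

theorem riemannZeta_eq_realZeta (i : ℕ) : riemannZeta (i + 2 : ℕ) = realZeta (i + 2) := by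
  rw [← classicalPolylog_one, classicalPolylog, realZeta, Complex.ofReal_tsum]
  refine tsum_congr fun k => ?_
  push_cast
  rw [one_pow]

theorem summable_doubleZetaTerm {a b : ℕ} (ha : 1 ≤ a) (hb : 2 ≤ b) :
    Summable (doubleZetaTerm a b) := by
  obtain ⟨c, rfl⟩ := Nat.exists_eq_add_of_le' hb
  refine (summable_tornheimTerm (p := c + 1) (by omega)).of_nonneg_of_le
    (fun x => by unfold doubleZetaTerm; positivity) fun x => ?_
  unfold doubleZetaTerm tornheimTerm
  apply one_div_le_one_div_of_le (by positivity)
  have h1 : ((x.1 : ℝ) + 1) ≤ (x.1 + 1) ^ a :=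
    le_self_pow₀ (by linarith [x.1.cast_nonneg (α := ℝ)]) (by omega)
  have h2 : ((x.2 : ℝ) + 1) ≤ x.1 + x.2 + 2 := by linarith [x.1.cast_nonneg (α := ℝ)]
  calc ((x.1 : ℝ) + 1) * (x.2 + 1) * (x.1 + x.2 + 2) ^ (c + 1)
      ≤ ((x.1 : ℝ) + 1) ^ a * (x.1 + x.2 + 2) * (x.1 + x.2 + 2) ^ (c + 1) := by gcongr
    _ = _ := by ring

theorem summable_mixedTerm {a c : ℕ} (ha : 1 ≤ a) (hc : 1 ≤ c) : Summable (mixedTerm a c) := by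
  refine (summable_tornheimTerm (p := 1) (by omega)).of_nonneg_of_le
    (fun x => by unfold mixedTerm; positivity) fun x => ?_
  unfold mixedTerm tornheimTerm
  apply one_div_le_one_div_of_le (by positivity)
  have hx := x.1.cast_nonneg (α := ℝ)
  have hx' := x.2.cast_nonneg (α := ℝ)
  have h1 : ((x.1 : ℝ) + 1) ≤ (x.1 + 1) ^ a := le_self_pow₀ (by linarith) (by omega)
  gcongr
  linarith

/-- With N = n + m, 1/(nm) = (1/n + 1/m)/N, and the two halves agree under n ↔ m. -/
theorem tsum_tornheimTerm_eq_two_mul {p : ℕ} (hp : 1 ≤ p) :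
    ∑' x, tornheimTerm p x = 2 * doubleZeta 1 (p + 1) := by
  have hs := summable_doubleZetaTerm le_rfl (show 2 ≤ p + 1 by omega)
  have h1 : ∑' x, doubleZetaTerm 1 (p + 1) (Prod.swap x) = doubleZeta 1 (p + 1) :=
    (Equiv.prodComm ℕ ℕ).tsum_eq _
  have hs' : Summable fun x => doubleZetaTerm 1 (p + 1) (Prod.swap x) :=
    (Equiv.prodComm ℕ ℕ).summable_iff.2 hs
  calc ∑' x, tornheimTerm p x
      = ∑' x, (doubleZetaTerm 1 (p + 1) x + doubleZetaTerm 1 (p + 1) (Prod.swap x)) := by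
        refine tsum_congr fun x => ?_
        simp only [tornheimTerm, doubleZetaTerm, Prod.fst_swap, Prod.snd_swap]
        rw [add_comm (x.2 : ℝ) x.1]
        have : (x.1 : ℝ) + x.2 + 2 ≠ 0 := by positivity
        field_simp
        ring
    _ = _ := by rw [hs.tsum_add hs', h1, doubleZeta]; ring

/-- Partial fractions 1/(mN) = (1/n)(1/m - 1/N) with N = n + m. Iteration carries exponents (1,1,p)
to (p,1,1), shedding a double zeta value each time. -/
theorem tsum_mixedTerm_succ {a c : ℕ} (ha : 1 ≤ a) (hc : 1 ≤ c) :
    ∑' x, mixedTerm a (c + 1) x = ∑' x, mixedTerm (a + 1) c x - doubleZeta (a + 1) (c + 1) := by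
  rw [doubleZeta, ← (summable_mixedTerm (by omega) hc).tsum_sub
    (summable_doubleZetaTerm (by omega) (by omega))]
  refine tsum_congr fun x => ?_
  simp only [mixedTerm, doubleZetaTerm]
  have : (x.1 : ℝ) + x.2 + 2 ≠ 0 := by positivity
  field_simp
  ring

theorem hasSum_triangle {f : ℕ × ℕ → ℝ} {a b c : ℝ} (ha : HasSum (fun n => f (n, n)) a)
    (hb : HasSum (fun x : ℕ × ℕ => f (x.1, x.1 + x.2 + 1)) b)
    (hc : HasSum (fun x : ℕ × ℕ => f (x.1 + x.2 + 1, x.1)) c) : HasSum f (a + b + c) := by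
  have ia : Function.Injective fun n : ℕ => (n, n) := fun n m h => (Prod.mk.inj h).1
  have ib : Function.Injective fun x : ℕ × ℕ => (x.1, x.1 + x.2 + 1) := fun x y h => by
    obtain ⟨h1, h2⟩ := Prod.mk.inj h
    ext <;> omega
  have ic : Function.Injective fun x : ℕ × ℕ => (x.1 + x.2 + 1, x.1) := fun x y h => by
    obtain ⟨h1, h2⟩ := Prod.mk.inj h
    ext <;> omega
  have ha' := ia.hasSum_range_iff (f := f) |>.2 ha
  have hb' := ib.hasSum_range_iff (f := f) |>.2 hb
  have hc' := ic.hasSum_range_iff (f := f) |>.2 hc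
  have h1 := HasSum.add_disjoint (by
    rw [Set.disjoint_left]
    rintro _ ⟨n, rfl⟩ ⟨x, hx⟩
    obtain ⟨h1, h2⟩ := Prod.mk.inj hx
    omega) ha' hb'
  have h2 := HasSum.add_isCompl (by
    refine ⟨Set.disjoint_left.2 ?_, codisjoint_iff_le_sup.2 ?_⟩
    · rintro _ (⟨n, rfl⟩ | ⟨y, rfl⟩) ⟨x, hx⟩ <;> obtain ⟨h1, h2⟩ := Prod.mk.inj hx <;> omega
    · rintro ⟨n, m⟩ -
      rcases lt_trichotomy n m with hlt | heq | hgt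
      · exact Or.inl (Or.inr ⟨(n, m - n - 1), by
          show (n, n + (m - n - 1) + 1) = (n, m); congr 1; omega⟩)
      · exact Or.inl (Or.inl ⟨n, by rw [heq]⟩)
      · exact Or.inr ⟨(m, n - m - 1), by
          show (m + (n - m - 1) + 1, m) = (n, m); congr 1; omega⟩) h1 hc'
  exact h2

/-- The stuffle product: the double sum splits into its diagonal and the two open triangles. -/
theorem realZeta_mul_realZeta {a b : ℕ} (ha : 2 ≤ a) (hb : 2 ≤ b) :
    realZeta a * realZeta b = realZeta (a + b) + doubleZeta a b + doubleZeta b a := by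
  have h1 := hasSum_realZeta (s := a) (by omega)
  have h2 := hasSum_realZeta (s := b) (by omega)
  have h3 := h1.mul h2 (h1.summable.mul_of_nonneg h2.summable
    (fun _ => by simp only [Pi.zero_apply]; positivity)
    (fun _ => by simp only [Pi.zero_apply]; positivity))
  refine h3.unique (hasSum_triangle ?_ ?_ ?_)
  · refine (hasSum_realZeta (s := a + b) (by omega)).congr_fun fun n => ?_
    rw [one_div_mul_one_div, pow_add]
  · refine (summable_doubleZetaTerm (a := a) (b := b) (by omega) hb).hasSum.congr_fun fun x => ?_
    rw [one_div_mul_one_div, doubleZetaTerm]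
    push_cast
    ring_nf
  · refine (summable_doubleZetaTerm (a := b) (b := a) (by omega) ha).hasSum.congr_fun fun x => ?_
    rw [one_div_mul_one_div, doubleZetaTerm]
    push_cast
    ring_nf

theorem hasSum_sub_shift {g : ℕ → ℝ} (hg : Tendsto g atTop (𝓝 0)) (hm : Antitone g) (q : ℕ) :
    HasSum (fun m => g m - g (m + q)) (∑ k ∈ Finset.range q, g k) := by
  rw [hasSum_iff_tendsto_nat_of_nonneg fun m => sub_nonneg.2 (hm (Nat.le_add_right m q))]
  have h1 : ∀ M, ∑ m ∈ Finset.range M, (g m - g (m + q)) =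
      ∑ k ∈ Finset.range q, g k - ∑ k ∈ Finset.range q, g (M + k) := fun M => by
    have h2 := Finset.sum_range_add g M q
    have h3 := Finset.sum_range_add g q M
    rw [add_comm q M] at h3
    rw [Finset.sum_sub_distrib]
    simp_rw [add_comm _ q]
    linarith
  simp_rw [h1]
  have h4 : Tendsto (fun M => ∑ k ∈ Finset.range q, g (M + k)) atTop (𝓝 0) := by
    have := tendsto_finsetSum (Finset.range q) fun k _ => (tendsto_add_atTop_iff_nat k).2 hg
    simpa using this
  simpa using tendsto_const_nhds.sub h4

/-- The partial fraction 1/m - 1/(m + n) telescopes to a harmonic number; indices here are shifted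
by one. -/
theorem tsum_one_div_mul_shift (n : ℕ) :
    ∑' m : ℕ, 1 / (((m : ℝ) + 1) * (n + m + 2)) =
      (∑ k ∈ Finset.range (n + 1), 1 / ((k : ℝ) + 1)) / (n + 1) := by
  have h := hasSum_sub_shift tendsto_one_div_add_atTop_nhds_zero_nat (fun a b hab => by
    show 1 / ((b : ℝ) + 1) ≤ 1 / ((a : ℝ) + 1)
    gcongr) (n + 1)
  rw [← (h.div_const ((n : ℝ) + 1)).tsum_eq]
  refine tsum_congr fun m => ?_
  have : (n : ℝ) + m + 2 ≠ 0 := by positivity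
  have : (m : ℝ) + n + 1 + 1 ≠ 0 := by positivity
  push_cast
  rw [← add_assoc]
  field_simp
  ring

/-- Summing over m first leaves the sum of H_n/n^{p+1}. The last term of each H_n gives the single
zeta value, the earlier ones the double zeta value. -/
theorem tsum_mixedTerm_one {p : ℕ} (hp : 1 ≤ p) :
    ∑' x, mixedTerm p 1 x = doubleZeta 1 (p + 1) + realZeta (p + 2) := by
  have h1 : HasSum (fun x : ℕ × ℕ =>
      if x.2 ≤ x.1 then 1 / (((x.2 : ℝ) + 1) * (x.1 + 1) ^ (p + 1)) else 0)
      (realZeta (p + 2) + 0 + doubleZeta 1 (p + 1)) := by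
    refine hasSum_triangle ?_ ?_ ?_
    · refine (hasSum_realZeta (s := p + 2) (by omega)).congr_fun fun n => ?_
      simp only [le_refl, if_true]
      ring
    · refine hasSum_zero.congr_fun fun x => ?_
      rw [if_neg]; simp only; omega
    · refine (summable_doubleZetaTerm (a := 1) (b := p + 1) le_rfl (by omega)).hasSum.congr_fun
        fun x => ?_
      rw [if_pos (by simp only; omega), doubleZetaTerm]
      push_cast
      ring_nf
  have h2 : ∑' x, mixedTerm p 1 x = ∑' n : ℕ, 1 / ((n : ℝ) + 1) ^ p *
      ((∑ k ∈ Finset.range (n + 1), 1 / ((k : ℝ) + 1)) / (n + 1)) := by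
    rw [(summable_mixedTerm hp le_rfl).tsum_prod]
    refine tsum_congr fun n => ?_
    rw [← tsum_one_div_mul_shift, ← tsum_mul_left]
    refine tsum_congr fun m => ?_
    rw [mixedTerm, one_div_mul_one_div]
    ring
  rw [h2]
  have h3 := h1.tsum_eq
  rw [h1.summable.tsum_prod] at h3
  rw [show doubleZeta 1 (p + 1) + realZeta (p + 2) =
    realZeta (p + 2) + 0 + doubleZeta 1 (p + 1) by ring, ← h3]
  refine tsum_congr fun n => ?_
  rw [tsum_eq_sum (s := Finset.range (n + 1)) fun k hk => by
    rw [if_neg]; simpa using hk]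
  rw [Finset.sum_div, Finset.mul_sum]
  refine Finset.sum_congr rfl fun k hk => ?_
  rw [if_pos (by simpa [Nat.lt_succ_iff] using hk)]
  field_simp
  ring

theorem tornheimTerm_eq_mixedTerm (p : ℕ) : tornheimTerm p = mixedTerm 1 p := by
  ext x
  rw [tornheimTerm, mixedTerm, pow_one]

/-- This and the next two evaluations use one elimination: the Tornheim sum is 2ζ(1,p+1), and also
ζ(1,p+1) + ζ(p+2) minus the ζ(a,b) with a,b ≥ 2 and a + b = p + 2, which the stuffle product sums in
closed form. -/
theorem tsum_tornheimTerm_two :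
    ∑' x, tornheimTerm 2 x = 3 * realZeta 4 - realZeta 2 ^ 2 := by
  have h1 := tsum_tornheimTerm_eq_two_mul (p := 2) (by norm_num)
  have h2 := tsum_mixedTerm_one (p := 2) (by norm_num)
  have h3 := tsum_mixedTerm_succ (a := 1) (c := 1) le_rfl le_rfl
  have h4 := realZeta_mul_realZeta (a := 2) (b := 2) le_rfl le_rfl
  norm_num at h1 h2 h3 h4
  rw [tornheimTerm_eq_mixedTerm] at *
  linarith

theorem tsum_tornheimTerm_three :
    ∑' x, tornheimTerm 3 x = 4 * realZeta 5 - 2 * realZeta 2 * realZeta 3 := by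
  have h1 := tsum_tornheimTerm_eq_two_mul (p := 3) (by norm_num)
  have h2 := tsum_mixedTerm_one (p := 3) (by norm_num)
  have h3 := tsum_mixedTerm_succ (a := 1) (c := 2) le_rfl (by norm_num)
  have h3' := tsum_mixedTerm_succ (a := 2) (c := 1) (by norm_num) le_rfl
  have h4 := realZeta_mul_realZeta (a := 2) (b := 3) le_rfl (by norm_num)
  norm_num at h1 h2 h3 h3' h4
  rw [tornheimTerm_eq_mixedTerm] at *
  linarith

theorem tsum_tornheimTerm_four :
    ∑' x, tornheimTerm 4 x =
      5 * realZeta 6 - 2 * realZeta 2 * realZeta 4 - realZeta 3 ^ 2 := by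
  have h1 := tsum_tornheimTerm_eq_two_mul (p := 4) (by norm_num)
  have h2 := tsum_mixedTerm_one (p := 4) (by norm_num)
  have h3 := tsum_mixedTerm_succ (a := 1) (c := 3) le_rfl (by norm_num)
  have h3' := tsum_mixedTerm_succ (a := 2) (c := 2) (by norm_num) (by norm_num)
  have h3'' := tsum_mixedTerm_succ (a := 3) (c := 1) (by norm_num) le_rfl
  have h4 := realZeta_mul_realZeta (a := 2) (b := 4) le_rfl (by norm_num)
  have h5 := realZeta_mul_realZeta (a := 3) (b := 3) (by norm_num) (by norm_num)
  norm_num at h1 h2 h3 h3' h3'' h4 h5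
  rw [tornheimTerm_eq_mixedTerm] at *
  linarith

/-! ### The sixth root of unity and branches of the logarithm -/

/-- The primitive sixth root of unity `exp (2 π i / 6)`. -/
noncomputable def sixthRoot : ℂ := Complex.exp (2 * (Real.pi : ℂ) * Complex.I / 6)

/-- `π i / 3 = log (exp (2 π i / 6))`. -/
noncomputable def piIThird : ℂ := Real.pi * Complex.I / 3

theorem sixthRoot_eq_exp : sixthRoot = Complex.exp piIThird := by
  rw [sixthRoot, piIThird]; congr 1; ring

theorem piIThird_im : piIThird.im = Real.pi / 3 := by
  rw [piIThird, show (Real.pi : ℂ) * Complex.I / 3 =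
    ((Real.pi / 3 : ℝ) : ℂ) * Complex.I by push_cast; ring]
  simp [-Complex.ofReal_div]

theorem sixthRoot_re : sixthRoot.re = 1 / 2 := by
  rw [sixthRoot_eq_exp, piIThird, show (Real.pi : ℂ) * Complex.I / 3 =
    ((Real.pi / 3 : ℝ) : ℂ) * Complex.I by push_cast; ring, Complex.exp_ofReal_mul_I_re,
    Real.cos_pi_div_three]

theorem sixthRoot_im : sixthRoot.im = Real.sqrt 3 / 2 := by
  rw [sixthRoot_eq_exp, piIThird, show (Real.pi : ℂ) * Complex.I / 3 =
    ((Real.pi / 3 : ℝ) : ℂ) * Complex.I by push_cast; ring, Complex.exp_ofReal_mul_I_im,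
    Real.sin_pi_div_three]

theorem norm_sixthRoot : ‖sixthRoot‖ = 1 := by
  rw [sixthRoot_eq_exp, piIThird, show (Real.pi : ℂ) * Complex.I / 3 =
    ((Real.pi / 3 : ℝ) : ℂ) * Complex.I by push_cast; ring, Complex.norm_exp_ofReal_mul_I]

theorem sixthRoot_ne_zero : sixthRoot ≠ 0 := Complex.exp_ne_zero _

theorem sixthRoot_sq : sixthRoot ^ 2 = sixthRoot - 1 := by
  have h := Real.sq_sqrt (show (0 : ℝ) ≤ 3 by norm_num)
  apply Complex.ext
  · simp only [sq, Complex.mul_re, Complex.sub_re, sixthRoot_re, sixthRoot_im, Complex.one_re]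
    linarith
  · simp only [sq, Complex.mul_im, Complex.sub_im, sixthRoot_re, sixthRoot_im, Complex.one_im]
    linarith

theorem log_sixthRoot : Complex.log sixthRoot = piIThird := by
  rw [sixthRoot_eq_exp, Complex.log_exp] <;> rw [piIThird_im] <;> linarith [Real.pi_pos]

theorem exp_neg_two_mul_piIThird : Complex.exp (-2 * piIThird) = -sixthRoot := by
  have h1 : Complex.exp (-2 * piIThird) * sixthRoot ^ 2 = 1 := by
    rw [sixthRoot_eq_exp, ← Complex.exp_nat_mul, ← Complex.exp_add]
    rw [show -2 * piIThird + ((2 : ℕ) : ℂ) * piIThird = 0 by push_cast; ring, Complex.exp_zero]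
  have h2 := sixthRoot_sq
  have h3 : sixthRoot ^ 3 = -1 := by linear_combination (sixthRoot + 1) * h2
  have h4 := sixthRoot_ne_zero
  have : sixthRoot ^ 2 ≠ 0 := pow_ne_zero _ h4
  apply mul_right_cancel₀ this
  rw [h1]
  linear_combination h3

theorem log_one_sub_sixthRoot : Complex.log (1 - sixthRoot) = -piIThird := by
  have h1 : (1 - sixthRoot) = Complex.exp (-piIThird) := by
    have h2 : Complex.exp (-piIThird) * sixthRoot = 1 := by
      rw [sixthRoot_eq_exp, ← Complex.exp_add, neg_add_cancel, Complex.exp_zero]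
    apply mul_right_cancel₀ sixthRoot_ne_zero
    linear_combination -h2 - sixthRoot_sq
  rw [h1, Complex.log_exp] <;> rw [Complex.neg_im, piIThird_im] <;> linarith [Real.pi_pos]

theorem log_mul_sixthRoot {t : ℝ} (ht : 0 < t) :
    Complex.log (sixthRoot * t) = Real.log t + piIThird := by
  rw [mul_comm, Complex.log_ofReal_mul ht sixthRoot_ne_zero, log_sixthRoot]

theorem one_sub_sixthRoot_mul_re (t : ℝ) : (1 - sixthRoot * t).re = 1 - t / 2 := by
  simp only [Complex.sub_re, Complex.one_re, Complex.mul_re, Complex.ofReal_re,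
    Complex.ofReal_im, sixthRoot_re, mul_zero, sub_zero]
  ring

theorem one_sub_sixthRoot_mul_im (t : ℝ) : (1 - sixthRoot * t).im = -(Real.sqrt 3 / 2 * t) := by
  simp only [Complex.sub_im, Complex.one_im, Complex.mul_im, Complex.ofReal_re,
    Complex.ofReal_im, sixthRoot_im, mul_zero]
  ring

theorem half_le_norm_one_sub_sixthRoot_mul {t : ℝ} (ht : t ≤ 1) :
    1 / 2 ≤ ‖1 - sixthRoot * t‖ := by
  have h1 := Complex.re_le_norm (1 - sixthRoot * t)
  rw [one_sub_sixthRoot_mul_re] at h1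
  linarith

theorem one_sub_sixthRoot_mul_ne_zero {t : ℝ} (ht : t ≤ 1) : 1 - sixthRoot * t ≠ 0 := by
  have h1 := half_le_norm_one_sub_sixthRoot_mul ht
  exact norm_pos_iff.1 (by linarith)

theorem log_inv_one_sub {t : ℝ} (ht : t ≤ 1) :
    Complex.log (1 - sixthRoot * t)⁻¹ = -Complex.log (1 - sixthRoot * t) := by
  refine Complex.log_inv _ fun h => ?_
  have := (Complex.arg_eq_pi_iff.1 h).1
  rw [one_sub_sixthRoot_mul_re] at this
  linarith

/-- The argument is -ωt/(1 - ωt) with -ω = exp(-2πi/3). Since arg(1 - ωt) lies in (-π/2, 0), the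
imaginary part of the right side stays in (-π, π), so no multiple of 2πi intervenes. -/
theorem log_one_sub_inv_one_sub {t : ℝ} (ht0 : 0 < t) (ht : t ≤ 1) :
    Complex.log (1 - (1 - sixthRoot * t)⁻¹) =
      Real.log t - 2 * piIThird - Complex.log (1 - sixthRoot * t) := by
  have hne := one_sub_sixthRoot_mul_ne_zero ht
  have h1 : 1 - (1 - sixthRoot * t)⁻¹ = Complex.exp
      (Real.log t - 2 * piIThird - Complex.log (1 - sixthRoot * t)) := by
    rw [Complex.exp_sub, Complex.exp_log hne, sub_eq_add_neg (Real.log t : ℂ), Complex.exp_add, ← neg_mul,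
      exp_neg_two_mul_piIThird, ← Complex.ofReal_exp, Real.exp_log ht0]
    field_simp
    ring
  have h2 : (1 - sixthRoot * t).arg < 0 := by
    rw [Complex.arg_neg_iff, one_sub_sixthRoot_mul_im]
    have : 0 < Real.sqrt 3 / 2 * t := by positivity
    linarith
  have h3 : |(1 - sixthRoot * t).arg| < Real.pi / 2 := by
    rw [Complex.abs_arg_lt_pi_div_two_iff, one_sub_sixthRoot_mul_re]
    left; linarith
  have h4 := (abs_lt.1 h3).1
  have him : (Real.log t - 2 * piIThird - Complex.log (1 - sixthRoot * t)).im =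
      -(2 * (Real.pi / 3)) - (1 - sixthRoot * t).arg := by
    rw [Complex.sub_im, Complex.sub_im, Complex.log_im, Complex.ofReal_im, ← piIThird_im]
    simp
  rw [h1, Complex.log_exp] <;> rw [him] <;> linarith [Real.pi_pos]

/-! ### Cauchy's theorem with logarithmic corners at 0 and 1 -/

/-- A disc through `0` and `1` that contains the open unit interval and `exp (2 π i / 6)`. -/
noncomputable def lensDisc : Set ℂ := Metric.ball ((1 + Complex.I) / 2) (Real.sqrt (1 / 2))

theorem mem_lensDisc {x : ℂ} : x ∈ lensDisc ↔ x.re ^ 2 + x.im ^ 2 < x.re + x.im := by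
  have h1 : ((1 + Complex.I) / 2).re = 1 / 2 := by simp
  have h2 : ((1 + Complex.I) / 2).im = 1 / 2 := by simp
  rw [lensDisc, mem_ball_iff_norm, Real.lt_sqrt (norm_nonneg _), Complex.sq_norm,
    Complex.normSq_apply, Complex.sub_re, Complex.sub_im, h1, h2]
  constructor <;> intro h <;> nlinarith

theorem convex_lensDisc : Convex ℝ lensDisc := convex_ball _ _

/-- A real point x of the disc satisfies x² < x, hence lies in (0,1); the disc therefore avoids the
cuts of both log x and log(1 - x). -/
theorem mem_slitPlane_of_mem_lensDisc {x : ℂ} (hx : x ∈ lensDisc) : x ∈ Complex.slitPlane := by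
  rw [mem_lensDisc] at hx
  rw [Complex.mem_slitPlane_iff]
  by_cases h : x.im = 0
  · left
    rw [h] at hx
    nlinarith
  · exact Or.inr h

theorem one_sub_mem_slitPlane_of_mem_lensDisc {x : ℂ} (hx : x ∈ lensDisc) :
    1 - x ∈ Complex.slitPlane := by
  rw [mem_lensDisc] at hx
  rw [Complex.mem_slitPlane_iff]
  by_cases h : x.im = 0
  · left
    rw [h] at hx
    simp only [Complex.sub_re, Complex.one_re]
    nlinarith
  · right
    simpa using h

theorem ofReal_mem_lensDisc {t : ℝ} (ht : t ∈ Ioo (0 : ℝ) 1) : (t : ℂ) ∈ lensDisc := by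
  rw [mem_lensDisc]
  simp only [Complex.ofReal_re, Complex.ofReal_im]
  nlinarith [ht.1, ht.2]

theorem sixthRoot_mul_mem_lensDisc {t : ℝ} (ht0 : 0 < t) (ht : t ≤ 1) :
    sixthRoot * t ∈ lensDisc := by
  rw [mem_lensDisc]
  have h := Real.sq_sqrt (show (0 : ℝ) ≤ 3 by norm_num)
  have h3 : 1 < Real.sqrt 3 := by rw [Real.lt_sqrt] <;> norm_num
  simp only [Complex.mul_re, Complex.mul_im, Complex.ofReal_re,
    Complex.ofReal_im, sixthRoot_re, sixthRoot_im, mul_zero, sub_zero, zero_add]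
  have h4 : (1 / 2 * t) ^ 2 + (Real.sqrt 3 / 2 * t) ^ 2 = t ^ 2 := by
    linear_combination t ^ 2 / 4 * h
  nlinarith

theorem inv_one_sub_mem_lensDisc {t : ℝ} (ht0 : 0 < t) (ht : t ≤ 1) :
    (1 - sixthRoot * t)⁻¹ ∈ lensDisc := by
  rw [mem_lensDisc]
  have hne := one_sub_sixthRoot_mul_ne_zero ht
  have hn : 0 < Complex.normSq (1 - sixthRoot * t) := Complex.normSq_pos.2 hne
  have h1 : (1 - sixthRoot * t)⁻¹.re ^ 2 + (1 - sixthRoot * t)⁻¹.im ^ 2 =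
      1 / Complex.normSq (1 - sixthRoot * t) := by
    rw [sq, sq, ← Complex.normSq_apply, Complex.normSq_inv, one_div]
  have h3 : 1 < Real.sqrt 3 := by rw [Real.lt_sqrt] <;> norm_num
  rw [h1, Complex.inv_re, Complex.inv_im, ← add_div, div_lt_div_iff_of_pos_right hn,
    one_sub_sixthRoot_mul_re, one_sub_sixthRoot_mul_im]
  nlinarith

theorem norm_log_le_pi_sub_log {x : ℂ} {c : ℝ} (hc : 0 < c) (h1 : c ≤ ‖x‖) (h2 : ‖x‖ ≤ 1) :
    ‖Complex.log x‖ ≤ Real.pi - Real.log c := by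
  have h3 := Complex.norm_le_abs_re_add_abs_im (Complex.log x)
  rw [Complex.log_re, Complex.log_im] at h3
  have h4 := Complex.abs_arg_le_pi x
  have h5 := Real.log_le_log hc h1
  have h6 := Real.log_nonpos (norm_nonneg x) h2
  rw [abs_of_nonpos h6] at h3
  linarith

theorem norm_log_one_sub_le {x : ℂ} (h : ‖x‖ ≤ 1 / 2) :
    ‖Complex.log (1 - x)‖ ≤ 3 / 2 * ‖x‖ := by
  have := Complex.norm_log_one_add_half_le_self (z := -x) (by rwa [norm_neg])
  rwa [norm_neg, ← sub_eq_add_neg] at this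

theorem hasUnitIntegral_tendsto {g : ℝ → ℂ} {v : ℂ} (hg : HasUnitIntegral g v)
    {ι : Type*} {l : Filter ι} {u w : ι → ℝ}
    (hu : Tendsto u l (𝓝 0)) (hw : Tendsto w l (𝓝 1))
    (hu' : ∀ᶠ x in l, u x ∈ Icc (0 : ℝ) 1) (hw' : ∀ᶠ x in l, w x ∈ Icc (0 : ℝ) 1) :
    Tendsto (fun x => ∫ t in u x..w x, g t) l (𝓝 v) := by
  have hI : IntegrableOn g (uIcc (0 : ℝ) 1) := by
    rw [uIcc_of_le zero_le_one, integrableOn_Icc_iff_integrableOn_Ioo]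
    exact hg.1
  have hc := intervalIntegral.continuousOn_primitive_interval hI
  rw [uIcc_of_le zero_le_one] at hc
  have h0 := (hc 0 (by simp)).tendsto.comp (tendsto_nhdsWithin_iff.2 ⟨hu, hu'⟩)
  have h1 := (hc 1 (by simp)).tendsto.comp (tendsto_nhdsWithin_iff.2 ⟨hw, hw'⟩)
  have h2 := h1.sub h0
  rw [intervalIntegral.integral_same, sub_zero, hg.intervalIntegral] at h2
  refine h2.congr' ?_
  filter_upwards [hu', hw'] with x hx hy
  have hi : ∀ y ∈ Icc (0 : ℝ) 1, IntervalIntegrable g volume 0 y := fun y hy =>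
    hg.intervalIntegrable.mono_set (by
      rw [uIcc_of_le zero_le_one, uIcc_of_le hy.1]; exact Icc_subset_Icc_right hy.2)
  exact intervalIntegral.integral_interval_sub_left (hi _ hy) (hi _ hx)

/-- The holomorphic integrand `log^i x · log^j (1 - x) / x`. -/
noncomputable def logForm (i j : ℕ) (x : ℂ) : ℂ :=
  Complex.log x ^ i * Complex.log (1 - x) ^ j / x

theorem differentiableOn_logForm (i j : ℕ) : DifferentiableOn ℂ (logForm i j) lensDisc := by
  intro x hx
  have h1 := mem_slitPlane_of_mem_lensDisc hx
  have h2 := one_sub_mem_slitPlane_of_mem_lensDisc hx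
  have h3 : DifferentiableAt ℂ (fun x : ℂ => Complex.log (1 - x)) x :=
    DifferentiableAt.clog (by fun_prop) h2
  exact ((((differentiableAt_id.clog h1).pow i).mul (h3.pow j)).div differentiableAt_id
    (Complex.slitPlane_ne_zero h1)).differentiableWithinAt

/-- At least one factor log(1 - x) is present, and its bound (3/2)|x| cancels the pole; only powers
of logarithms remain. -/
theorem norm_logForm_le_near_zero {i j : ℕ} {x : ℂ} {c : ℝ} (hc : 0 < c) (hc1 : c ≤ 1)
    (h1 : c ≤ ‖x‖) (h2 : ‖x‖ ≤ 1 / 2) :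
    ‖logForm i (j + 1) x‖ ≤ 2 * (Real.pi - Real.log c) ^ (i + j + 1) := by
  have hl := norm_log_le_pi_sub_log hc h1 (by linarith)
  have hx : 0 < ‖x‖ := hc.trans_le h1
  have hb := norm_log_one_sub_le h2
  have h3 := Real.log_nonpos hc.le hc1
  have h4 : 1 ≤ Real.pi - Real.log c := by linarith [Real.pi_gt_three]
  have h5 : ‖Complex.log (1 - x)‖ ≤ 1 := by linarith
  rw [logForm, norm_div, norm_mul, norm_pow, norm_pow, div_le_iff₀ hx, pow_succ]
  calc ‖Complex.log x‖ ^ i * (‖Complex.log (1 - x)‖ ^ j * ‖Complex.log (1 - x)‖)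
      ≤ (Real.pi - Real.log c) ^ i * (1 ^ j * (3 / 2 * ‖x‖)) := by gcongr
    _ ≤ (Real.pi - Real.log c) ^ (i + j + 1) * (1 ^ j * (2 * ‖x‖)) := by
        refine mul_le_mul (pow_le_pow_right₀ h4 (by omega)) ?_ (by positivity) (by positivity)
        gcongr
        norm_num
    _ = _ := by rw [one_pow]; ring

theorem norm_logForm_le_near_one {i j : ℕ} {x : ℂ} {c : ℝ} (hc : 0 < c) (hc1 : c ≤ 1)
    (h1 : c ≤ ‖1 - x‖) (h2 : ‖1 - x‖ ≤ 1 / 2) :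
    ‖logForm i (j + 1) x‖ ≤ 2 * (Real.pi - Real.log c) ^ (i + j + 1) := by
  have hl := norm_log_le_pi_sub_log hc h1 (by linarith)
  have hb := norm_log_one_sub_le h2
  rw [sub_sub_cancel] at hb
  have h3 := Real.log_nonpos hc.le hc1
  have h4 : 1 ≤ Real.pi - Real.log c := by linarith [Real.pi_gt_three]
  have h5 : ‖Complex.log x‖ ≤ 1 := by linarith
  have hx : 1 / 2 ≤ ‖x‖ := by
    have := norm_sub_norm_le 1 (1 - x)
    rw [sub_sub_cancel, norm_one] at this
    linarith
  rw [logForm, norm_div, norm_mul, norm_pow, norm_pow, div_le_iff₀ (by linarith)]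
  calc ‖Complex.log x‖ ^ i * ‖Complex.log (1 - x)‖ ^ (j + 1)
      ≤ 1 ^ i * (Real.pi - Real.log c) ^ (j + 1) := by gcongr
    _ ≤ 1 ^ i * (Real.pi - Real.log c) ^ (i + j + 1) :=
        mul_le_mul_of_nonneg_left (pow_le_pow_right₀ h4 (by omega)) (by positivity)
    _ = 2 * (Real.pi - Real.log c) ^ (i + j + 1) * (1 / 2) := by rw [one_pow]; ring
    _ ≤ _ := by gcongr

theorem tendsto_pi_sub_log_pow_mul (n : ℕ) :
    Tendsto (fun ε : ℝ => 8 * (Real.pi - Real.log (ε / 4)) ^ n * ε) (𝓝[>] 0) (𝓝 0) := by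
  have hI : ∀ᶠ t : ℝ in 𝓝[>] 0, t ∈ Ioo (0 : ℝ) 1 := Ioo_mem_nhdsGT zero_lt_one
  have h4 : Real.log 4 ≤ 3 := (Real.log_le_sub_one_of_pos (by norm_num)).trans (by norm_num)
  have hlim := (tendsto_logWeight_pow_mul n).const_mul (8 * 8 ^ n)
  rw [mul_zero] at hlim
  have hb : ∀ t ∈ Ioo (0 : ℝ) 1, 0 ≤ Real.pi - Real.log (t / 4) ∧
      Real.pi - Real.log (t / 4) ≤ 8 * logWeight t := fun t ht => by
    rw [Real.log_div ht.1.ne' (by norm_num)]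
    have h1 := neg_log_nonneg ht
    have h2 := neg_log_nonneg (one_sub_mem_Ioo ht)
    have h5 : 0 ≤ Real.log 4 := Real.log_nonneg (by norm_num)
    unfold logWeight
    constructor <;> linarith [Real.pi_gt_three, Real.pi_lt_four]
  refine squeeze_zero' (hI.mono fun t ht => ?_) (hI.mono fun t ht => ?_) hlim
  · have := (hb t ht).1
    have := ht.1
    positivity
  · obtain ⟨h1, h2⟩ := hb t ht
    have := ht.1
    calc _ ≤ 8 * (8 * logWeight t) ^ n * t := by gcongr
      _ = _ := by rw [mul_pow]; ring

theorem norm_primitive_sub_le {F f : ℂ → ℂ} (hF : ∀ z ∈ lensDisc, HasDerivAt F (f z) z) {x y : ℂ}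
    (hx : x ∈ lensDisc) (hy : y ∈ lensDisc) {C : ℝ} (h : ∀ z ∈ segment ℝ x y, ‖f z‖ ≤ C) :
    ‖F y - F x‖ ≤ C * ‖y - x‖ :=
  Convex.norm_image_sub_le_of_norm_hasDerivWithin_le
    (fun z hz => (hF z (convex_lensDisc.segment_subset hx hy hz)).hasDerivWithinAt) h
    (convex_segment x y) (left_mem_segment ℝ x y) (right_mem_segment ℝ x y)

/-- Used to keep a short segment at distance of order ε from a corner: a suitable rotation w puts
both endpoints in one right half-plane. -/
theorem re_mul_ge_of_mem_segment {x y z w : ℂ} {c : ℝ} (hz : z ∈ segment ℝ x y)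
    (hx : c ≤ (x * w).re) (hy : c ≤ (y * w).re) : c ≤ (z * w).re := by
  obtain ⟨a, b, ha, hb, hab, rfl⟩ := hz
  have : ((a • x + b • y) * w).re = a * (x * w).re + b * (y * w).re := by
    simp only [Complex.real_smul, add_mul, mul_assoc, Complex.add_re, Complex.re_ofReal_mul]
  rw [this]
  calc c = a * c + b * c := by rw [← add_mul, hab, one_mul]
    _ ≤ _ := by gcongr

theorem norm_le_of_mem_segment {x y z : ℂ} {c : ℝ} (hz : z ∈ segment ℝ x y)
    (hx : ‖x‖ ≤ c) (hy : ‖y‖ ≤ c) : ‖z‖ ≤ c := by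
  have := (convex_closedBall (0 : ℂ) c).segment_subset (mem_closedBall_zero_iff.2 hx)
    (mem_closedBall_zero_iff.2 hy) hz
  exact mem_closedBall_zero_iff.1 this

/-- The chord from ε to ωε has length O(ε), while the form on it is bounded by a power of log(1/ε).
-/
theorem tendsto_primitive_near_zero {F : ℂ → ℂ} {i j : ℕ}
    (hF : ∀ z ∈ lensDisc, HasDerivAt F (logForm i (j + 1) z) z) :
    Tendsto (fun ε : ℝ => F (sixthRoot * ε) - F ε) (𝓝[>] 0) (𝓝 0) := by
  have hI : ∀ᶠ t : ℝ in 𝓝[>] 0, t ∈ Ioo (0 : ℝ) (1 / 4) := Ioo_mem_nhdsGT (by norm_num)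
  refine squeeze_zero_norm' (hI.mono fun t ht => ?_) (tendsto_pi_sub_log_pow_mul (i + j + 1))
  obtain ⟨ht0, ht1⟩ := ht
  have hn1 : ‖(t : ℂ)‖ = t := Complex.norm_of_nonneg ht0.le
  have hn2 : ‖sixthRoot * t‖ = t := by rw [norm_mul, norm_sixthRoot, hn1, one_mul]
  have h := norm_primitive_sub_le hF (ofReal_mem_lensDisc ⟨ht0, by linarith⟩)
    (sixthRoot_mul_mem_lensDisc ht0 (by linarith))
    (C := 2 * (Real.pi - Real.log (t / 4)) ^ (i + j + 1)) fun z hz => by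
      refine norm_logForm_le_near_zero (by linarith) (by linarith) ?_
        ((norm_le_of_mem_segment hz hn1.le hn2.le).trans (by linarith))
      have := re_mul_ge_of_mem_segment (w := 1) (c := t / 4) hz
        (by rw [mul_one, Complex.ofReal_re]; linarith)
        (by rw [mul_one, Complex.re_mul_ofReal, sixthRoot_re]; linarith)
      rw [mul_one] at this
      exact this.trans (Complex.re_le_norm z)
  have hsub : ‖sixthRoot * t - t‖ ≤ 2 * t := (norm_sub_le _ _).trans (by rw [hn1, hn2]; linarith)
  have hl : 0 ≤ Real.pi - Real.log (t / 4) := by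
    linarith [Real.log_nonpos (show 0 ≤ t / 4 by linarith) (by linarith), Real.pi_pos]
  calc _ ≤ _ := h
    _ ≤ 2 * (Real.pi - Real.log (t / 4)) ^ (i + j + 1) * (2 * t) := by gcongr
    _ = 4 * (Real.pi - Real.log (t / 4)) ^ (i + j + 1) * t := by ring
    _ ≤ _ := by gcongr; norm_num

theorem tendsto_primitive_near_one {F : ℂ → ℂ} {i j : ℕ}
    (hF : ∀ z ∈ lensDisc, HasDerivAt F (logForm i (j + 1) z) z) :
    Tendsto (fun ε : ℝ => F (1 - sixthRoot * ε)⁻¹ - F ((1 / (1 + ε) : ℝ) : ℂ))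
      (𝓝[>] 0) (𝓝 0) := by
  have hI : ∀ᶠ t : ℝ in 𝓝[>] 0, t ∈ Ioo (0 : ℝ) (1 / 4) := Ioo_mem_nhdsGT (by norm_num)
  refine squeeze_zero_norm' (hI.mono fun t ht => ?_) (tendsto_pi_sub_log_pow_mul (i + j + 1))
  obtain ⟨ht0, ht1⟩ := ht
  have hne := one_sub_sixthRoot_mul_ne_zero (t := t) (by linarith)
  have hhalf := half_le_norm_one_sub_sixthRoot_mul (t := t) (by linarith)
  have hv1 : 1 - ((1 / (1 + t) : ℝ) : ℂ) = ((t / (1 + t) : ℝ) : ℂ) := by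
    rw [← Complex.ofReal_one, ← Complex.ofReal_sub]
    congr 1
    field_simp
    ring
  have hv2 : 1 - (1 - sixthRoot * t)⁻¹ = -(sixthRoot * t) * (1 - sixthRoot * t)⁻¹ := by
    field_simp
    ring
  have hn1 : ‖1 - ((1 / (1 + t) : ℝ) : ℂ)‖ ≤ 2 * t := by
    rw [hv1, Complex.norm_of_nonneg (by positivity), div_le_iff₀ (by linarith)]
    nlinarith
  have hn2 : ‖1 - (1 - sixthRoot * t)⁻¹‖ ≤ 2 * t := by
    rw [hv2, norm_mul, norm_neg, norm_mul, norm_sixthRoot, norm_inv,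
      Complex.norm_of_nonneg ht0.le, one_mul, ← div_eq_mul_inv, div_le_iff₀ (by linarith)]
    nlinarith
  -- Seen from the corner 1, the endpoints lie in the directions 1 and, to first order, -ω.
  -- Multiplication by ω moves these to ω and 1 - ω, both with real part 1/2.
  have hr1 : t / 4 ≤ ((1 - ((1 / (1 + t) : ℝ) : ℂ)) * sixthRoot).re := by
    rw [hv1, Complex.re_ofReal_mul, sixthRoot_re, div_mul_eq_mul_div, le_div_iff₀ (by linarith)]
    nlinarith
  have hr2 : t / 4 ≤ ((1 - (1 - sixthRoot * t)⁻¹) * sixthRoot).re := by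
    have h0 : (1 - (1 - sixthRoot * t)⁻¹) * sixthRoot =
        (t : ℂ) * ((1 - sixthRoot) * (1 - sixthRoot * t)⁻¹) := by
      rw [hv2]
      linear_combination (-(t : ℂ) * (1 - sixthRoot * t)⁻¹) * sixthRoot_sq
    have hs : Complex.normSq (1 - sixthRoot * t) = 1 - t + t ^ 2 := by
      have h := Real.sq_sqrt (show (0 : ℝ) ≤ 3 by norm_num)
      rw [Complex.normSq_apply, one_sub_sixthRoot_mul_re, one_sub_sixthRoot_mul_im]
      linear_combination t ^ 2 / 4 * h
    have h1 : ((1 - sixthRoot) * (1 - sixthRoot * t)⁻¹).re = (1 / 2 + t / 2) / (1 - t + t ^ 2) := by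
      have h := Real.sq_sqrt (show (0 : ℝ) ≤ 3 by norm_num)
      rw [Complex.mul_re, Complex.inv_re, Complex.inv_im, hs, one_sub_sixthRoot_mul_re,
        one_sub_sixthRoot_mul_im, Complex.sub_re, Complex.sub_im, sixthRoot_re, sixthRoot_im,
        Complex.one_re, Complex.one_im]
      rw [← mul_div_assoc, ← mul_div_assoc, ← sub_div]
      congr 1
      linear_combination t / 4 * h
    rw [h0, Complex.re_ofReal_mul, h1, div_eq_mul_one_div]
    have h2 : 0 < 1 - t + t ^ 2 := by nlinarith
    refine mul_le_mul_of_nonneg_left ?_ ht0.le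
    rw [le_div_iff₀ h2]
    nlinarith
  have h := norm_primitive_sub_le hF
    (ofReal_mem_lensDisc (t := 1 / (1 + t)) ⟨by positivity, by
      rw [div_lt_one (by linarith)]; linarith⟩)
    (inv_one_sub_mem_lensDisc ht0 (by linarith))
    (C := 2 * (Real.pi - Real.log (t / 4)) ^ (i + j + 1)) fun z hz => by
      have hz' : 1 - z ∈ segment ℝ (1 - ((1 / (1 + t) : ℝ) : ℂ)) (1 - (1 - sixthRoot * t)⁻¹) := by
        obtain ⟨a, b, ha, hb, hab, rfl⟩ := hz
        refine ⟨a, b, ha, hb, hab, ?_⟩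
        have : (a : ℂ) + b = 1 := by exact_mod_cast hab
        simp only [Complex.real_smul]
        linear_combination this
      refine norm_logForm_le_near_one (by linarith) (by linarith) ?_
        ((norm_le_of_mem_segment hz' hn1 hn2).trans (by linarith))
      have h1 := re_mul_ge_of_mem_segment hz' hr1 hr2
      have h2 := Complex.re_le_norm ((1 - z) * sixthRoot)
      rw [norm_mul, norm_sixthRoot, mul_one] at h2
      exact h1.trans h2
  have hsub : ‖(1 - sixthRoot * t)⁻¹ - ((1 / (1 + t) : ℝ) : ℂ)‖ ≤ 4 * t := by
    have := norm_sub_le (1 - ((1 / (1 + t) : ℝ) : ℂ)) (1 - (1 - sixthRoot * t)⁻¹)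
    rw [sub_sub_sub_cancel_left] at this
    linarith
  have hl : 0 ≤ Real.pi - Real.log (t / 4) := by
    linarith [Real.log_nonpos (show 0 ≤ t / 4 by linarith) (by linarith), Real.pi_pos]
  calc _ ≤ _ := h
    _ ≤ 2 * (Real.pi - Real.log (t / 4)) ^ (i + j + 1) * (4 * t) := by gcongr
    _ = _ := by ring

/-! ### Pullbacks to the ray and the arc -/

theorem HasUnitIntegral.sum {ι : Type*} {f : ι → ℝ → ℂ} {v : ι → ℂ} (s : Finset ι)
    (h : ∀ i ∈ s, HasUnitIntegral (f i) (v i)) :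
    HasUnitIntegral (fun t => ∑ i ∈ s, f i t) (∑ i ∈ s, v i) :=
  ⟨integrable_finsetSum s fun i hi => (h i hi).1, by
    rw [integral_finsetSum s fun i hi => (h i hi).1]
    exact Finset.sum_congr rfl fun i hi => (h i hi).2⟩

/-- The pullback of `logForm` to the ray from `0` to `exp (2 π i / 6)`. -/
noncomputable def rayIntegrand (i j : ℕ) (t : ℝ) : ℂ :=
  (Real.log t + piIThird) ^ i * Complex.log (1 - sixthRoot * t) ^ j / t

/-- The pullback of `logForm` to the arc `1 / (1 - exp (2 π i / 6) t)`. -/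
noncomputable def arcIntegrand (i j : ℕ) (t : ℝ) : ℂ :=
  (-Complex.log (1 - sixthRoot * t)) ^ i *
    (Real.log t - 2 * piIThird - Complex.log (1 - sixthRoot * t)) ^ j *
      (sixthRoot / (1 - sixthRoot * t))

theorem measurable_log_one_sub_mul (z : ℂ) :
    Measurable fun t : ℝ => Complex.log (1 - z * (t : ℂ)) :=
  Complex.measurable_log.comp (by fun_prop)

theorem measurable_ofReal_log : Measurable fun t : ℝ => ((Real.log t : ℝ) : ℂ) :=
  Complex.measurable_ofReal.comp Real.measurable_log

theorem norm_piIThird_le : ‖piIThird‖ ≤ 2 := by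
  rw [piIThird, norm_div, norm_mul, Complex.norm_I, Complex.norm_real, Real.norm_eq_abs,
    abs_of_pos Real.pi_pos]
  norm_num
  linarith [Real.pi_lt_four]

theorem integrableOn_rayIntegrand (i j : ℕ) : IntegrableOn (rayIntegrand i (j + 1)) (Ioo 0 1) := by
  refine integrableOn_of_le_logWeight (C := 3 ^ i) (i + j + 1) ?_ fun t ht => ?_
  · exact ((((measurable_ofReal_log.add_const _).pow_const i).mul
      ((measurable_log_one_sub_mul _).pow_const _)).div
        Complex.measurable_ofReal).aestronglyMeasurable
  · have hw := one_le_logWeight ht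
    have h1 : ‖(Real.log t : ℂ) + piIThird‖ ≤ 3 * logWeight t :=
      (norm_add_le _ _).trans (by linarith [norm_log_le_logWeight ht, norm_piIThird_le])
    calc ‖rayIntegrand i (j + 1) t‖
        = ‖(Real.log t : ℂ) + piIThird‖ ^ i * ‖Complex.log (1 - sixthRoot * t)‖ ^ j *
          ‖Complex.log (1 - sixthRoot * t) / t‖ := by
          rw [← norm_pow, ← norm_pow, ← norm_mul, ← norm_mul]
          unfold rayIntegrand; congr 1; ring
      _ ≤ (3 * logWeight t) ^ i * logWeight t ^ j * logWeight t := by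
          gcongr
          · exact norm_log_one_sub_le_logWeight norm_sixthRoot.le ht
          · exact norm_log_one_sub_div_le_logWeight norm_sixthRoot.le ht
      _ = _ := by rw [mul_pow]; ring

theorem integrableOn_arcIntegrand (i j : ℕ) : IntegrableOn (arcIntegrand i j) (Ioo 0 1) := by
  refine integrableOn_of_le_logWeight (C := 6 ^ j * 2) (i + j) ?_ fun t ht => ?_
  · have h3 : Measurable fun t : ℝ => sixthRoot / (1 - sixthRoot * (t : ℂ)) := by fun_prop
    exact ((((measurable_log_one_sub_mul _).neg.pow_const i).mul
      (((measurable_ofReal_log.sub_const _).sub (measurable_log_one_sub_mul _)).pow_const _)).mul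
        h3).aestronglyMeasurable
  · have hw := one_le_logWeight ht
    have hl := norm_log_one_sub_le_logWeight norm_sixthRoot.le ht
    have h1 : ‖(Real.log t : ℂ) - 2 * piIThird - Complex.log (1 - sixthRoot * t)‖ ≤
        6 * logWeight t := by
      refine (norm_sub_le _ _).trans ?_
      have h2 := norm_sub_le (Real.log t : ℂ) (2 * piIThird)
      have h3 : ‖2 * piIThird‖ ≤ 4 := by
        rw [norm_mul, Complex.norm_ofNat]; linarith [norm_piIThird_le]
      linarith [norm_log_le_logWeight ht]
    have hb : ‖sixthRoot / (1 - sixthRoot * t)‖ ≤ 2 := by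
      have h1 := half_le_norm_one_sub_sixthRoot_mul ht.2.le
      rw [norm_div, norm_sixthRoot, div_le_iff₀ (by linarith)]
      linarith
    rw [arcIntegrand, norm_mul, norm_mul, norm_pow, norm_pow, norm_neg]
    calc _ ≤ logWeight t ^ i * (6 * logWeight t) ^ j * 2 := by gcongr
      _ = _ := by rw [mul_pow]; ring

theorem hasDerivAt_comp_ray {F : ℂ → ℂ} {i j : ℕ}
    (hF : ∀ z ∈ lensDisc, HasDerivAt F (logForm i j z) z) {t : ℝ} (ht0 : 0 < t) (ht : t ≤ 1) :
    HasDerivAt (fun t : ℝ => F (sixthRoot * t)) (rayIntegrand i j t) t := by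
  have h1 : HasDerivAt (fun t : ℝ => sixthRoot * (t : ℂ)) sixthRoot t := by
    simpa using (Complex.ofRealCLM.hasDerivAt (x := t)).const_mul sixthRoot
  refine ((hF _ (sixthRoot_mul_mem_lensDisc ht0 ht)).scomp t h1).congr_deriv ?_
  have ht0' : (t : ℂ) ≠ 0 := by exact_mod_cast ht0.ne'
  have := sixthRoot_ne_zero
  rw [logForm, log_mul_sixthRoot ht0, rayIntegrand, smul_eq_mul]
  field_simp

theorem hasDerivAt_comp_arc {F : ℂ → ℂ} {i j : ℕ}
    (hF : ∀ z ∈ lensDisc, HasDerivAt F (logForm i j z) z) {t : ℝ} (ht0 : 0 < t) (ht : t ≤ 1) :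
    HasDerivAt (fun t : ℝ => F (1 - sixthRoot * t)⁻¹) (arcIntegrand i j t) t := by
  have hne := one_sub_sixthRoot_mul_ne_zero ht
  have h1 : HasDerivAt (fun t : ℝ => (1 - sixthRoot * (t : ℂ))⁻¹)
      (sixthRoot / (1 - sixthRoot * t) ^ 2) t := by
    have : HasDerivAt (fun t : ℝ => 1 - sixthRoot * (t : ℂ)) (-sixthRoot) t := by
      simpa using ((Complex.ofRealCLM.hasDerivAt (x := t)).const_mul sixthRoot).const_sub 1
    exact (this.inv hne).congr_deriv (by rw [neg_neg])
  refine ((hF _ (inv_one_sub_mem_lensDisc ht0 ht)).scomp t h1).congr_deriv ?_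
  rw [logForm, log_inv_one_sub ht, log_one_sub_inv_one_sub ht0 ht, arcIntegrand, smul_eq_mul]
  field_simp

theorem hasDerivAt_comp_unit {F : ℂ → ℂ} {i j : ℕ}
    (hF : ∀ z ∈ lensDisc, HasDerivAt F (logForm i j z) z) {t : ℝ} (ht : t ∈ Ioo (0 : ℝ) 1) :
    HasDerivAt (fun t : ℝ => F t) (logMomentIntegrand 1 i j t) t := by
  refine ((hF _ (ofReal_mem_lensDisc ht)).comp_ofReal).congr_deriv ?_
  rw [logForm, logMomentIntegrand, Complex.ofReal_log ht.1.le, one_mul]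

theorem HasUnitIntegral.integral_eq_sub {f F : ℝ → ℂ} {v : ℂ} (h : HasUnitIntegral f v) {a b : ℝ}
    (ha : a ∈ Icc (0 : ℝ) 1) (hb : b ∈ Icc (0 : ℝ) 1)
    (hF : ∀ t ∈ uIcc a b, HasDerivAt F (f t) t) : ∫ t in a..b, f t = F b - F a := by
  refine intervalIntegral.integral_eq_sub_of_hasDerivAt hF (h.intervalIntegrable.mono_set ?_)
  rw [uIcc_of_le zero_le_one]
  exact uIcc_subset_Icc ha hb

/-- Cauchy's theorem for `logForm` on the triangle with vertices `0`, `1`, `exp (2 π i / 6)`. -/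
theorem integral_ray_sub_integral_arc (i j : ℕ) :
    (∫ t in Ioo (0 : ℝ) 1, rayIntegrand i (j + 1) t) -
      ∫ t in Ioo (0 : ℝ) 1, arcIntegrand i (j + 1) t = logMoment 1 i (j + 1) := by
  obtain ⟨F, hF⟩ := (differentiableOn_logForm i (j + 1)).isExactOn_ball
  have hF : ∀ z ∈ lensDisc, HasDerivAt F (logForm i (j + 1) z) z := hF
  have h1 := HasUnitIntegral.of_integrableOn (integrableOn_rayIntegrand i j)
  have h2 := HasUnitIntegral.of_integrableOn (integrableOn_arcIntegrand i (j + 1))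
  have h3 := hasUnitIntegral_logMoment (z := 1) (by simp) i (Nat.add_one_ne_zero j)
  have hI : ∀ᶠ t : ℝ in 𝓝[>] 0, t ∈ Ioo (0 : ℝ) 1 := Ioo_mem_nhdsGT zero_lt_one
  have hid : Tendsto (fun ε : ℝ => ε) (𝓝[>] 0) (𝓝 0) := nhdsWithin_le_nhds
  have hinv : Tendsto (fun ε : ℝ => 1 / (1 + ε)) (𝓝[>] 0) (𝓝 1) := by
    have : ContinuousAt (fun ε : ℝ => 1 / (1 + ε)) 0 :=
      ContinuousAt.div (by fun_prop) (by fun_prop) (by norm_num)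
    have h := this.tendsto
    simp only [add_zero, div_one] at h
    exact h.mono_left nhdsWithin_le_nhds
  have hmem : ∀ ε ∈ Ioo (0 : ℝ) 1, 1 / (1 + ε) ∈ Ioo (0 : ℝ) 1 := fun ε hε =>
    ⟨by have := hε.1; positivity, by rw [div_lt_one (by linarith [hε.1])]; linarith [hε.1]⟩
  have hI' : ∀ᶠ t : ℝ in 𝓝[>] 0, t ∈ Icc (0 : ℝ) 1 := hI.mono fun t ht => Ioo_subset_Icc_self ht
  have hone : ∀ᶠ t : ℝ in 𝓝[>] 0, (1 : ℝ) ∈ Icc (0 : ℝ) 1 := .of_forall fun _ => by simp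
  have l1 := hasUnitIntegral_tendsto h1 hid tendsto_const_nhds hI' hone
  have l2 := hasUnitIntegral_tendsto h2 hid tendsto_const_nhds hI' hone
  have l3 := hasUnitIntegral_tendsto h3 hid hinv hI'
    (hI.mono fun t ht => Ioo_subset_Icc_self (hmem t ht))
  -- In terms of the primitive, ray minus arc minus interval, cut off at ε, is exactly the gap at 1
  -- minus the gap at 0; the values at ω cancel.
  have l4 := (tendsto_primitive_near_one hF).sub (tendsto_primitive_near_zero hF)
  have l5 := (l1.sub l2).sub l3
  have l6 := tendsto_nhds_unique (l5.congr' ?_) l4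
  · linear_combination l6
  · filter_upwards [hI] with ε hε
    have hεI := Ioo_subset_Icc_self hε
    have hle : ∀ t ∈ uIcc ε 1, 0 < t ∧ t ≤ 1 := fun t ht => by
      rw [uIcc_of_le hε.2.le] at ht
      exact ⟨hε.1.trans_le ht.1, ht.2⟩
    rw [h1.integral_eq_sub hεI (by simp) fun t ht =>
        hasDerivAt_comp_ray hF (hle t ht).1 (hle t ht).2,
      h2.integral_eq_sub hεI (by simp) fun t ht =>
        hasDerivAt_comp_arc hF (hle t ht).1 (hle t ht).2,
      h3.integral_eq_sub hεI (Ioo_subset_Icc_self (hmem ε hε)) fun t ht =>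
        hasDerivAt_comp_unit hF (ordConnected_Ioo.uIcc_subset hε (hmem ε hε) ht)]
    -- Ray and arc end at the same point because ω(1 - ω) = 1.
    have hω : (1 - sixthRoot * ((1 : ℝ) : ℂ))⁻¹ = sixthRoot * ((1 : ℝ) : ℂ) := by
      refine inv_eq_of_mul_eq_one_right ?_
      push_cast
      linear_combination -sixthRoot_sq
    rw [hω]
    ring

/-! ### The contour relations between moments at ω and at 1 -/

/-- The value of `∫_0^1 log^m t · log^n (1 - ω t) · ω dt / (1 - ω t)`. -/
noncomputable def dlogMoment : ℕ → ℕ → ℂ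
  | 0, n => -(-piIThird) ^ (n + 1) / (n + 1)
  | m + 1, n => (m + 1) / (n + 1) * logMoment sixthRoot m (n + 1)

theorem hasUnitIntegral_dlogMoment (m n : ℕ) :
    HasUnitIntegral (fun t : ℝ => (Real.log t : ℂ) ^ m * Complex.log (1 - sixthRoot * t) ^ n *
      (sixthRoot / (1 - sixthRoot * t))) (dlogMoment m n) := by
  have hr : sixthRoot.re ≤ 1 / 2 := sixthRoot_re.le
  cases m with
  | zero =>
    have := hasUnitIntegral_dlog_zero norm_sixthRoot.le hr n
    rw [log_one_sub_sixthRoot] at this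
    simpa [dlogMoment] using this
  | succ m => exact hasUnitIntegral_dlog_succ norm_sixthRoot.le hr m n

/-- Cauchy's theorem on the triangle `0`, `1`, `ω` for the form `(log x - log ω)^i log^j (1 - x)
dx / x`, with all integrals expanded in moments. -/
theorem logMoment_sixthRoot_contour (i j : ℕ) :
    logMoment sixthRoot i (j + 1) -
      ∑ p ∈ Finset.range (i + 1), ∑ q ∈ Finset.range (j + 2),
        ∑ r ∈ Finset.range (j + 1 - q + 1),
          ((-1) ^ i * piIThird ^ (i - p) * i.choose p * ((j + 1).choose q : ℂ) *
            ((-1) ^ r * (-2 * piIThird) ^ (j + 1 - q - r) * ((j + 1 - q).choose r : ℂ))) *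
              dlogMoment q (p + r) =
      ∑ k ∈ Finset.range (i + 1),
        ((-piIThird) ^ (i - k) * (i.choose k : ℂ)) * logMoment 1 k (j + 1) := by
  have h1 := HasUnitIntegral.sum (Finset.range (i + 1)) fun k _ =>
    (HasUnitIntegral.of_integrableOn (integrableOn_rayIntegrand k j)).const_mul
      ((-piIThird) ^ (i - k) * (i.choose k : ℂ))
  have h2 := HasUnitIntegral.sum (Finset.range (i + 1)) fun k _ =>
    (HasUnitIntegral.of_integrableOn (integrableOn_arcIntegrand k (j + 1))).const_mul
      ((-piIThird) ^ (i - k) * (i.choose k : ℂ))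
  -- On the ray log x - log ω = log t, so the shifted form gives a single moment at ω.
  have h3 := h1.congr (g := logMomentIntegrand sixthRoot i (j + 1)) fun t ht => by
    have := add_pow ((Real.log t : ℂ) + piIThird) (-piIThird) i
    rw [add_neg_cancel_right] at this
    rw [logMomentIntegrand, this, Finset.sum_mul, Finset.sum_div]
    refine Finset.sum_congr rfl fun k _ => ?_
    rw [rayIntegrand]
    ring
  have h4 := HasUnitIntegral.sum (Finset.range (i + 1)) fun p _ =>
    HasUnitIntegral.sum (Finset.range (j + 2)) fun q _ =>
      HasUnitIntegral.sum (Finset.range (j + 1 - q + 1)) fun r _ =>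
        (hasUnitIntegral_dlogMoment q (p + r)).const_mul
          ((-1) ^ i * piIThird ^ (i - p) * i.choose p * ((j + 1).choose q : ℂ) *
            ((-1) ^ r * (-2 * piIThird) ^ (j + 1 - q - r) * ((j + 1 - q).choose r : ℂ)))
  -- On the arc log x - log ω = -(log(1 - ωt) + πi/3). Expanding this power binomially in p and that
  -- of log(1 - x) trinomially in q and r leaves only the integrals `dlogMoment`.
  have h5 := h4.congr (g := fun t : ℝ => ∑ k ∈ Finset.range (i + 1),
      ((-piIThird) ^ (i - k) * (i.choose k : ℂ)) * arcIntegrand k (j + 1) t) fun t ht => by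
    have e1 := add_pow (-Complex.log (1 - sixthRoot * t)) (-piIThird) i
    have e2 := add_pow (Complex.log (1 - sixthRoot * t)) piIThird i
    have e3 := add_pow (Real.log t : ℂ)
      (-Complex.log (1 - sixthRoot * t) + -2 * piIThird) (j + 1)
    have e4 : (Real.log t : ℂ) + (-Complex.log (1 - sixthRoot * t) + -2 * piIThird) =
      Real.log t - 2 * piIThird - Complex.log (1 - sixthRoot * t) := by ring
    rw [e4] at e3
    calc _ = (-Complex.log (1 - sixthRoot * t) + -piIThird) ^ i *
          (Real.log t - 2 * piIThird - Complex.log (1 - sixthRoot * t)) ^ (j + 1) *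
            (sixthRoot / (1 - sixthRoot * t)) := by
          rw [e1, Finset.sum_mul, Finset.sum_mul]
          refine Finset.sum_congr rfl fun k _ => ?_
          rw [arcIntegrand]
          ring
      _ = (-1) ^ i * (Complex.log (1 - sixthRoot * t) + piIThird) ^ i *
          (Real.log t - 2 * piIThird - Complex.log (1 - sixthRoot * t)) ^ (j + 1) *
            (sixthRoot / (1 - sixthRoot * t)) := by
          rw [← mul_pow]; ring
      _ = _ := by
          rw [e2, Finset.mul_sum, Finset.sum_mul, Finset.sum_mul]
          refine Finset.sum_congr rfl fun p _ => ?_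
          rw [e3, Finset.mul_sum, Finset.sum_mul]
          refine Finset.sum_congr rfl fun q _ => ?_
          rw [add_pow, Finset.mul_sum, Finset.sum_mul, Finset.mul_sum, Finset.sum_mul]
          refine Finset.sum_congr rfl fun r _ => ?_
          rw [neg_pow (Complex.log (1 - sixthRoot * t)) r]
          ring
  have h6 := hasUnitIntegral_logMoment norm_sixthRoot.le i (Nat.add_one_ne_zero j)
  rw [← h3.unique h6, ← h2.unique h5, ← Finset.sum_sub_distrib]
  refine Finset.sum_congr rfl fun k _ => ?_
  rw [← integral_ray_sub_integral_arc]
  ring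

/-- The multipliers solve a linear system: of the moments at ω in the contour relations, only those
belonging to S_{3,3}, S_{3,2}, Li_4 and Li_6 survive. -/
theorem logMoment_sixthRoot_relation :
    2 * logMoment sixthRoot 2 3 + 6 * piIThird * logMoment sixthRoot 2 2 +
      6 * piIThird ^ 2 * logMoment sixthRoot 2 1 - 3 * logMoment sixthRoot 4 1 =
    -4 * logMoment 1 4 1 + 2 * logMoment 1 3 2 - 1 / 5 * logMoment 1 0 5 +
      piIThird * (20 * logMoment 1 3 1 - 6 * logMoment 1 2 2 - logMoment 1 0 4) -
      piIThird ^ 2 * (36 * logMoment 1 2 1 - 6 * logMoment 1 1 2 + 2 * logMoment 1 0 3) +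
      piIThird ^ 3 * (28 * logMoment 1 1 1 - 4 * logMoment 1 0 2) -
      9 * piIThird ^ 4 * logMoment 1 0 1 + 28 / 15 * piIThird ^ 6 := by
  have r41 := logMoment_sixthRoot_contour 4 0
  have r32 := logMoment_sixthRoot_contour 3 1
  have r31 := logMoment_sixthRoot_contour 3 0
  have r01 := logMoment_sixthRoot_contour 0 0
  have r02 := logMoment_sixthRoot_contour 0 1
  have r03 := logMoment_sixthRoot_contour 0 2
  have r04 := logMoment_sixthRoot_contour 0 3
  have r05 := logMoment_sixthRoot_contour 0 4
  norm_num [Finset.sum_range_succ, Nat.choose, dlogMoment] at r41 r32 r31 r01 r02 r03 r04 r05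
  linear_combination -4 * r41 + 2 * r32 + 4 * piIThird * r31 - 1 / 5 * r05 - piIThird * r04
    - 2 * piIThird ^ 2 * r03 - 2 * piIThird ^ 3 * r02 - piIThird ^ 4 * r01

-- The multipliers are chosen so that every moment at ω cancels. What remains evaluates `logMoment 1
-- 2 3`, on which duality is vacuous.
set_option maxHeartbeats 1000000 in
theorem logMoment_one_contour_relation :
    logMoment 1 4 1 - logMoment 1 3 2 + logMoment 1 2 3 - 1 / 2 * logMoment 1 1 4 +
      1 / 5 * logMoment 1 0 5 -
      piIThird * (6 * logMoment 1 3 1 - 6 * logMoment 1 2 2 + 4 * logMoment 1 1 3 -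
        3 / 2 * logMoment 1 0 4) +
      piIThird ^ 2 * (15 * logMoment 1 2 1 - 12 * logMoment 1 1 2 + 5 * logMoment 1 0 3) -
      piIThird ^ 3 * (18 * logMoment 1 1 1 - 9 * logMoment 1 0 2) +
      9 * piIThird ^ 4 * logMoment 1 0 1 - 27 / 20 * piIThird ^ 6 = 0 := by
  have r41 := logMoment_sixthRoot_contour 4 0
  have r32 := logMoment_sixthRoot_contour 3 1
  have r31 := logMoment_sixthRoot_contour 3 0
  have r23 := logMoment_sixthRoot_contour 2 2
  have r22 := logMoment_sixthRoot_contour 2 1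
  have r21 := logMoment_sixthRoot_contour 2 0
  have r14 := logMoment_sixthRoot_contour 1 3
  have r13 := logMoment_sixthRoot_contour 1 2
  have r12 := logMoment_sixthRoot_contour 1 1
  have r11 := logMoment_sixthRoot_contour 1 0
  have r01 := logMoment_sixthRoot_contour 0 0
  have r02 := logMoment_sixthRoot_contour 0 1
  have r03 := logMoment_sixthRoot_contour 0 2
  have r04 := logMoment_sixthRoot_contour 0 3
  have r05 := logMoment_sixthRoot_contour 0 4
  norm_num [Finset.sum_range_succ, Nat.choose, dlogMoment] at r41 r32 r31 r23 r22 r21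
  norm_num [Finset.sum_range_succ, Nat.choose, dlogMoment] at r14 r13 r12 r11 r01 r02 r03 r04 r05
  linear_combination -r41 + r32 + 2 * piIThird * r31 - r23 - 3 * piIThird * r22
    - 3 * piIThird ^ 2 * r21 + 1 / 2 * r14 + 2 * piIThird * r13 + 3 * piIThird ^ 2 * r12
    + 2 * piIThird ^ 3 * r11
    - 1 / 5 * r05 - piIThird * r04 - 2 * piIThird ^ 2 * r03 - 2 * piIThird ^ 3 * r02
    - piIThird ^ 4 * r01

/-! ### Explicit moments at 1 -/

theorem logMoment_one_values :
    logMoment 1 0 1 = -riemannZeta 2 ∧ logMoment 1 1 1 = riemannZeta 3 ∧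
    logMoment 1 2 1 = -2 * riemannZeta 4 ∧ logMoment 1 3 1 = 6 * riemannZeta 5 ∧
    logMoment 1 4 1 = -24 * riemannZeta 6 := by
  have h0 := logMoment_one_one 0
  have h1 := logMoment_one_one 1
  have h2 := logMoment_one_one 2
  have h3 := logMoment_one_one 3
  have h4 := logMoment_one_one 4
  norm_num [Nat.factorial] at h0 h1 h2 h3 h4
  exact ⟨h0, h1, by rw [h2]; ring, h3, by rw [h4]; ring⟩

theorem logMoment_one_zero_values :
    logMoment 1 0 2 = 2 * riemannZeta 3 ∧ logMoment 1 0 3 = -6 * riemannZeta 4 ∧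
    logMoment 1 0 4 = 24 * riemannZeta 5 ∧ logMoment 1 0 5 = -120 * riemannZeta 6 := by
  obtain ⟨-, v1, v2, v3, v4⟩ := logMoment_one_values
  have h1 := logMoment_one_succ 1 0
  have h2 := logMoment_one_succ 2 0
  have h3 := logMoment_one_succ 3 0
  have h4 := logMoment_one_succ 4 0
  norm_num at h1 h2 h3 h4
  refine ⟨?_, ?_, ?_, ?_⟩
  · linear_combination 2 * v1 - h1
  · linear_combination 3 * v2 - h2
  · linear_combination 4 * v3 - h3
  · linear_combination 5 * v4 - h4

theorem logMoment_one_two_values :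
    logMoment 1 1 2 = riemannZeta 2 ^ 2 - 3 * riemannZeta 4 ∧
    logMoment 1 2 2 = 8 * riemannZeta 5 - 4 * riemannZeta 2 * riemannZeta 3 ∧
    logMoment 1 3 2 = -6 * (5 * riemannZeta 6 - 2 * riemannZeta 2 * riemannZeta 4 -
      riemannZeta 3 ^ 2) := by
  have z2 := riemannZeta_eq_realZeta 0
  have z3 := riemannZeta_eq_realZeta 1
  have z4 := riemannZeta_eq_realZeta 2
  have z5 := riemannZeta_eq_realZeta 3
  have z6 := riemannZeta_eq_realZeta 4
  norm_num at z2 z3 z4 z5 z6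
  rw [z2, z3, z4, z5, z6]
  refine ⟨?_, ?_, ?_⟩
  · rw [logMoment_one_two, tsum_tornheimTerm_two, Nat.factorial_one]
    push_cast
    ring
  · rw [logMoment_one_two, tsum_tornheimTerm_three, Nat.factorial_two]
    push_cast
    ring
  · rw [logMoment_one_two, tsum_tornheimTerm_four, show Nat.factorial 3 = 6 from rfl]
    push_cast
    ring

theorem riemannZeta_six : riemannZeta 6 = (Real.pi : ℂ) ^ 6 / 945 := by
  have h := riemannZeta_two_mul_nat (k := 3) (by norm_num)
  have hb : bernoulli 6 = 1 / 42 := by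
    rw [bernoulli_eq_bernoulli'_of_ne_one (by norm_num)]
    have h5 : bernoulli' 5 = 0 := bernoulli'_eq_zero_of_odd (by decide) (by norm_num)
    rw [bernoulli'_def]
    norm_num [Finset.sum_range_succ, Nat.choose, h5]
  rw [show 2 * ((3 : ℕ) : ℂ) = 6 by norm_num, show 2 * 3 = 6 from rfl, hb] at h
  rw [h]
  norm_num [Nat.factorial]
  ring

/-! ### Folding at -1 -/

theorem logMoment_neg_one_relation :
    2 * logMoment (-1) 2 3 - 3 * logMoment (-1) 3 2 + logMoment (-1) 4 1 =
      -logMoment 1 4 1 + logMoment 1 3 2 + logMoment 1 2 3 - logMoment 1 1 4 := by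
  have hn : ‖(-1 : ℂ)‖ ≤ 1 := by simp
  have h1 : ‖(1 : ℂ)‖ ≤ 1 := by simp
  have hL := (((hasUnitIntegral_logMoment hn 2 three_ne_zero).const_mul 2).add
    ((hasUnitIntegral_logMoment hn 3 two_ne_zero).const_mul (-3))).add
      (hasUnitIntegral_logMoment hn 4 one_ne_zero)
  have hR := ((((hasUnitIntegral_logMoment h1 4 one_ne_zero).const_mul (-1)).add
    (hasUnitIntegral_logMoment h1 3 two_ne_zero)).add
      (hasUnitIntegral_logMoment h1 2 three_ne_zero)).add
        ((hasUnitIntegral_logMoment h1 1 four_ne_zero).const_mul (-1))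
  -- Put a = log s, b = log(1 - s). For t = (1 - s)/s one has log t = b - a and log(1 + t) = -a, and
  -- the coefficients 2, -3, 1 are those for which 2a² + 3a(b - a) + (b - a)² = b(a + b). The
  -- integrand thus becomes symmetric in a and b.
  set H : ℝ → ℂ := fun s => -(Real.log (1 - s) - Real.log s) ^ 2 *
    (Real.log s * Real.log (1 - s) * (Real.log s + Real.log (1 - s))) with hH
  have hR' := hR.congr (g := fun s => H s / s) fun s hs => by
    simp only [logMomentIntegrand, hH, one_mul]
    have hl := Complex.ofReal_log (one_sub_mem_Ioo hs).1.le
    rw [Complex.ofReal_sub, Complex.ofReal_one] at hl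
    rw [hl]
    ring
  have hsym : ∀ s, H (1 - s) = H s := fun s => by
    simp only [hH, sub_sub_cancel]; ring
  have hI := hR'.intervalIntegrable
  have hsub : ∀ a ∈ Icc (0 : ℝ) 1, ∀ b ∈ Icc (0 : ℝ) 1,
      IntervalIntegrable (fun s : ℝ => H s / s) volume a b := fun a ha b hb =>
    hI.mono_set (by rw [uIcc_of_le zero_le_one]; exact uIcc_subset_Icc ha hb)
  have hh : (1 / 2 : ℝ) ∈ Icc (0 : ℝ) 1 := by constructor <;> norm_num
  -- Here |dt|/t = (1/s + 1/(1 - s)) ds. By the symmetry of `H`, the second summand on (1/2,1) is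
  -- the reflection of H(s)/s on (0,1/2).
  have hfold : ∫ s in (1 / 2 : ℝ)..1, (H s / s + H s / (1 - s)) =
      -logMoment 1 4 1 + logMoment 1 3 2 + logMoment 1 2 3 - logMoment 1 1 4 := by
    have hc : IntervalIntegrable (fun s : ℝ => H (1 - s) / ((1 - s : ℝ) : ℂ)) volume (1 / 2) 1 := by
      have := (hsub 0 (by simp) (1 / 2) hh).comp_sub_left 1
      norm_num at this
      simpa using this.symm
    have e1 := intervalIntegral.integral_comp_sub_left (a := 1 / 2) (b := 1)
      (fun s : ℝ => H s / s) 1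
    norm_num at e1
    have e2 := intervalIntegral.integral_add_adjacent_intervals (hsub 0 (by simp) (1 / 2) hh)
      (hsub (1 / 2) hh 1 (by simp))
    rw [hR'.intervalIntegral] at e2
    have e3 := intervalIntegral.integral_add (hsub (1 / 2) hh 1 (by simp)) hc
    simp only [hsym, Complex.ofReal_sub, Complex.ofReal_one] at e1 e3
    rw [e3, e1]
    norm_num at e2 ⊢
    linear_combination e2
  have himg : (fun s : ℝ => (1 - s) / s) '' Ioo (1 / 2) 1 = Ioo 0 1 := by
    ext t
    constructor
    · rintro ⟨s, hs, rfl⟩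
      have h0 : 0 < s := by linarith [hs.1]
      exact ⟨div_pos (by linarith [hs.2]) h0, by rw [div_lt_one h0]; linarith [hs.1]⟩
    · rintro ⟨h0, ht⟩
      refine ⟨1 / (1 + t), ⟨?_, ?_⟩, ?_⟩
      · rw [div_lt_div_iff₀] <;> linarith
      · rw [div_lt_one] <;> linarith
      · field_simp
        ring
  have hinj : InjOn (fun s : ℝ => (1 - s) / s) (Ioo (1 / 2) 1) := by
    intro a ha b hb hab
    have ha0 : a ≠ 0 := by linarith [ha.1]
    have hb0 : b ≠ 0 := by linarith [hb.1]
    simp only at hab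
    rw [div_eq_div_iff ha0 hb0] at hab
    linarith
  have hderiv : ∀ s ∈ Ioo (1 / 2 : ℝ) 1, HasDerivWithinAt (fun s : ℝ => (1 - s) / s)
      (-1 / s ^ 2) (Ioo (1 / 2) 1) s := fun s hs => by
    have hs0 : s ≠ 0 := by linarith [hs.1]
    have := (((hasDerivAt_id s).const_sub 1).div (hasDerivAt_id s) hs0).hasDerivWithinAt
      (s := Ioo (1 / 2) 1)
    refine this.congr_deriv ?_
    simp only [id]
    ring
  have hsubst := integral_image_eq_integral_abs_deriv_smul measurableSet_Ioo hderiv hinj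
    (fun t => 2 * logMomentIntegrand (-1) 2 3 t + -3 * logMomentIntegrand (-1) 3 2 t +
      logMomentIntegrand (-1) 4 1 t)
  rw [himg, hL.2] at hsubst
  rw [intervalIntegral.integral_of_le (by norm_num), integral_Ioc_eq_integral_Ioo] at hfold
  rw [← hfold]
  refine Eq.trans (by ring) (hsubst.trans (setIntegral_congr_fun measurableSet_Ioo fun s hs => ?_))
  have h0 : 0 < s := by linarith [hs.1]
  have h1s : 0 < 1 - s := by linarith [hs.2]
  have hl : Complex.log (1 - -1 * (((1 - s) / s : ℝ) : ℂ)) = -(Real.log s : ℂ) := by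
    rw [show 1 - -1 * (((1 - s) / s : ℝ) : ℂ) = ((s⁻¹ : ℝ) : ℂ) by
      have : (s : ℂ) ≠ 0 := by exact_mod_cast h0.ne'
      push_cast; field_simp; ring, ← Complex.ofReal_log (by positivity), Real.log_inv]
    push_cast; rfl
  have habs : |(-1 / s ^ 2 : ℝ)| = 1 / s ^ 2 := by
    rw [neg_div, abs_neg, abs_of_pos (by positivity)]
  simp only [logMomentIntegrand, hl, hH]
  rw [habs, Complex.real_smul, Real.log_div h1s.ne' h0.ne']
  have hc0 : (s : ℂ) ≠ 0 := by exact_mod_cast h0.ne'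
  have hc1 : (1 - s : ℂ) ≠ 0 := by exact_mod_cast h1s.ne'
  push_cast
  field_simp
  ring

/-- The even integers, sitting at odd indices because of the shift, contribute ζ(6)/64, so the
alternating sum is (2/64 - 1)ζ(6). -/
theorem classicalPolylog_six_neg_one : classicalPolylog 6 (-1) = -31 / 32 * riemannZeta 6 := by
  set f : ℕ → ℂ := fun j => 1 / ((j : ℂ) + 1) ^ 6 with hf
  have hs : Summable f := by
    have := (summable_nat_add_iff 1).2 (Real.summable_one_div_nat_pow.2 (show 1 < 6 by norm_num))
    refine (Complex.summable_ofReal.2 this).congr fun j => ?_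
    simp [hf]
  have hz : ∑' j, f j = riemannZeta 6 := by
    have h := classicalPolylog_one 4
    norm_num [classicalPolylog] at h
    rw [← h]
    exact tsum_congr fun j => by simp [hf]
  have he : Summable fun k => f (2 * k) := hs.comp_injective fun a b h => by simpa using h
  have ho : Summable fun k => f (2 * k + 1) := hs.comp_injective fun a b h => by simpa using h
  have h1 := tsum_even_add_odd he ho
  have h2 : ∑' k, f (2 * k + 1) = 1 / 64 * ∑' k, f k := by
    rw [← tsum_mul_left]
    refine tsum_congr fun k => ?_
    have hk : (k : ℂ) + 1 ≠ 0 := by exact_mod_cast k.succ_ne_zero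
    simp only [hf]
    push_cast
    rw [show (2 : ℂ) * k + 1 + 1 = 2 * (k + 1) by ring, mul_pow]
    field_simp
    norm_num
  have he' : HasSum (fun k => (-1) ^ (2 * k + 1) * f (2 * k)) (-∑' k, f (2 * k)) :=
    he.hasSum.neg.congr_fun fun k => by rw [pow_succ, pow_mul]; simp
  have ho' : HasSum (fun k => (-1) ^ (2 * k + 1 + 1) * f (2 * k + 1)) (∑' k, f (2 * k + 1)) :=
    ho.hasSum.congr_fun fun k => by rw [pow_succ, pow_succ, pow_mul]; simp
  have h3 := (he'.even_add_odd (f := fun j => (-1) ^ (j + 1) * f j) ho').tsum_eq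
  have h4 : classicalPolylog 6 (-1) = ∑' j, (-1) ^ (j + 1) * f j := by
    refine tsum_congr fun j => ?_
    simp only [hf]
    push_cast
    ring
  rw [h4, h3]
  rw [hz] at h1 h2
  linear_combination 2 * h2 - h1

/-! ### The two evaluations -/

theorem nielsenPolylog_three_three_neg_one :
    nielsenPolylog 3 3 (-1) =
      3 / 2 * nielsenPolylog 4 2 (-1) + 5 / 16 * riemannZeta 6 - 1 / 4 * riemannZeta 3 ^ 2 := by
  have hn : ‖(-1 : ℂ)‖ ≤ 1 := by simp
  obtain ⟨v0, v1, v2, v3, v4⟩ := logMoment_one_values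
  obtain ⟨w2, w3, w4, w5⟩ := logMoment_one_zero_values
  obtain ⟨x1, x2, x3⟩ := logMoment_one_two_values
  have y3 := logMoment_one_succ 1 2
  have y4 := logMoment_one_succ 1 3
  have hc := logMoment_one_contour_relation
  have hk := logMoment_neg_one_relation
  have h41 := logMoment_one_eq_classicalPolylog hn 4
  rw [classicalPolylog_six_neg_one] at h41
  rw [nielsenPolylog_eq_logMoment hn _ three_ne_zero, nielsenPolylog_eq_logMoment hn _ two_ne_zero]
  norm_num [Nat.factorial] at y3 y4 h41 ⊢
  have y3' : logMoment 1 1 3 = 12 * riemannZeta 5 - 6 * riemannZeta 2 * riemannZeta 3 := by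
    rw [x2] at y3
    linear_combination y3 / 2
  have y4' : logMoment 1 1 4 = -12 * (5 * riemannZeta 6 - 2 * riemannZeta 2 * riemannZeta 4 -
      riemannZeta 3 ^ 2) := by
    rw [x3] at y4
    linear_combination y4 / 2
  rw [v0, v1, v2, v3, v4, w2, w3, w4, w5, x1, x2, x3, y3', y4', riemannZeta_two, riemannZeta_four,
    riemannZeta_six, piIThird] at hc
  rw [v4, x3, y4', h41, riemannZeta_two, riemannZeta_four, riemannZeta_six] at hk
  rw [riemannZeta_six]
  have e2 := Complex.I_sq
  have e3 : Complex.I ^ 3 = -Complex.I := Complex.I_pow_three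
  have e4 : Complex.I ^ 4 = 1 := Complex.I_pow_four
  have e6 : Complex.I ^ 6 = -1 := by rw [show 6 = 4 + 2 from rfl, pow_add, e4, e2, one_mul]
  simp only [mul_pow, div_pow, e2, e3, e4, e6] at hc
  -- S_{3,3} is -1/12 of its moment, which enters `hk` with coefficient 2. In `hc` the terms with
  -- odd powers of πi cancel identically once the moments are evaluated.
  linear_combination -1 / 24 * hk - 1 / 24 * hc

theorem nielsenPolylog_three_three_sixthRoot :
    nielsenPolylog 3 3 sixthRoot =
        3 * classicalPolylog 6 sixthRoot
          - 1 / 2 * riemannZeta 3 ^ 2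
          - 1829 / 1944 * riemannZeta 6
          + 1 / 3 * Complex.I * (Real.pi : ℂ) * (nielsenPolylog 3 2 sixthRoot - 2 * riemannZeta 5)
          + 1 / 3 * riemannZeta 2 * classicalPolylog 4 sixthRoot
          + 1 / 324 * (2 * Complex.I * (Real.pi : ℂ)) ^ 3 * riemannZeta 3 := by
  have hn := norm_sixthRoot.le
  obtain ⟨v0, v1, v2, v3, v4⟩ := logMoment_one_values
  obtain ⟨w2, w3, w4, w5⟩ := logMoment_one_zero_values
  obtain ⟨x1, x2, x3⟩ := logMoment_one_two_values
  have hc := logMoment_sixthRoot_relation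
  have h41 := logMoment_one_eq_classicalPolylog hn 4
  have h21 := logMoment_one_eq_classicalPolylog hn 2
  rw [nielsenPolylog_eq_logMoment hn _ three_ne_zero, nielsenPolylog_eq_logMoment hn _ two_ne_zero]
  norm_num [Nat.factorial] at h41 h21 ⊢
  rw [v0, v1, v2, v3, v4, w2, w3, w4, w5, x1, x2, x3, h41, h21, riemannZeta_two, riemannZeta_four,
    riemannZeta_six, piIThird] at hc
  rw [riemannZeta_two, riemannZeta_six]
  have e2 := Complex.I_sq
  have e3 : Complex.I ^ 3 = -Complex.I := Complex.I_pow_three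
  have e4 : Complex.I ^ 4 = 1 := Complex.I_pow_four
  have e6 : Complex.I ^ 6 = -1 := by rw [show 6 = 4 + 2 from rfl, pow_add, e4, e2, one_mul]
  simp only [mul_pow, div_pow, e2, e3, e4, e6] at hc ⊢
  -- The same normalisation; even zeta values are by now rational multiples of powers of π, so the
  -- powers of πi/3 combine with them.
  linear_combination -1 / 24 * hc

theorem mainTheorem11 :
    (nielsenPolylog 3 3 (-1) =
      3 / 2 * nielsenPolylog 4 2 (-1) + 5 / 16 * riemannZeta 6 - 1 / 4 * riemannZeta 3 ^ 2) ∧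
    (∀ ω : ℂ, ω = Complex.exp (2 * (Real.pi : ℂ) * Complex.I / 6) →
      nielsenPolylog 3 3 ω =
        3 * classicalPolylog 6 ω
          - 1 / 2 * riemannZeta 3 ^ 2
          - 1829 / 1944 * riemannZeta 6
          + 1 / 3 * Complex.I * (Real.pi : ℂ) * (nielsenPolylog 3 2 ω - 2 * riemannZeta 5)
          + 1 / 3 * riemannZeta 2 * classicalPolylog 4 ω
          + 1 / 324 * (2 * Complex.I * (Real.pi : ℂ)) ^ 3 * riemannZeta 3) :=
  ⟨nielsenPolylog_three_three_neg_one, by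
    rintro ω rfl
    exact nielsenPolylog_three_three_sixthRoot⟩
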